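/- Let $p$ be an odd prime, let $F$ be a field containing a primitive $p$-th root of unity, and fix a separable closure $\bar F^{s}$ of $F$, in which all extensions of $F$ below are taken. Write $F^p=\{c^p : c\in F\}$. An element $a\in F\smallsetminus F^p$ is called $p$-rigid if the image of the norm map $N\colon F(\sqrt[p]{a})\to F$ is contained in $\bigcup_{k=0}^{p-1}a^kF^p$, and the field $F$ is called $p$-rigid if every $a\in F\smallsetminus F^p$ is $p$-rigid. Let $F^{(2)}=F^{\{2\}}=F(\sqrt[p]{F})$ be the extension of $F$ generated by all $p$-th roots of elements of $F$. For $n\ge 3$ define recursively: $F^{\{n\}}$ is the compositum of $F^{\{n-1\}}$ and all Galois extensions $L/F^{\{n-1\}}$ of degree $p$; and $F^{(n)}$ is the compositum of $F^{(n-1)}$ and all Galois extensions $L/F^{(n-1)}$ of degree $p$ for which $L/F$ is also Galois. Then $F$ is $p$-rigid if and only if $F^{(3)}=F^{\{3\}}$. More precisely: (a) if $F$ is $p$-rigid, then $F^{\{n\}}=F^{(n)}$ for all $n\ge 2$; (b) if $F$ is not $p$-rigid, then $F^{(3)}\subsetneq F^{\{3\}}$. -/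

import Mathlib

open Polynomial

noncomputable section

namespace RigidField

/-- `a` is `p`-rigid: `a` is not a `p`-th power in `F`, and the image of the norm map
`F(a^(1/p)) → F` is contained in the union of the sets `a ^ k * F ^ p`, `0 ≤ k ≤ p - 1`.
For `p` prime and `a` not a `p`-th power, `X ^ p - a` is irreducible over `F`,
so `AdjoinRoot (X ^ p - C a)` is the field `F(a^(1/p))`. -/
def IsPRigidElement (p : ℕ) {F : Type*} [Field F] (a : F) : Prop :=
  (∀ c : F, c ^ p ≠ a) ∧
    ∀ x : AdjoinRoot (X ^ p - C a : F[X]),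
      ∃ k < p, ∃ c : F, Algebra.norm F x = a ^ k * c ^ p

/-- The field `F` is `p`-rigid: every element that is not a `p`-th power is `p`-rigid. -/
def IsPRigid (p : ℕ) (F : Type*) [Field F] : Prop :=
  ∀ a : F, (∀ c : F, c ^ p ≠ a) → IsPRigidElement p a

section Towers

variable (p : ℕ) (F Ω : Type*) [Field F] [Field Ω] [Algebra F Ω]

/-- `F^(2)`: the subfield of `Ω` generated over `F` by all `p`-th roots of elements of `F`. -/
def kummerExt : IntermediateField F Ω :=
  IntermediateField.adjoin F {α : Ω | ∃ a : F, α ^ p = algebraMap F Ω a}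

variable {F Ω}

/-- `L` is a Galois extension of `K` of degree `p`, inside `Ω`. -/
def IsGaloisOfDegree (K L : IntermediateField F Ω) : Prop :=
  ∃ h : K ≤ L, IsGalois K (IntermediateField.extendScalars h) ∧
    Module.finrank K (IntermediateField.extendScalars h) = p

/-- The compositum, over `K`, of all Galois extensions `L / K` of degree `p`
(it is `K` itself when there are none). -/
def curlyStep (K : IntermediateField F Ω) : IntermediateField F Ω :=
  K ⊔ sSup {L : IntermediateField F Ω | IsGaloisOfDegree p K L}

/-- The compositum, over `K`, of all Galois extensions `L / K` of degree `p` for which `L / F` is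
also Galois (it is `K` itself when there are none). -/
def roundStep (K : IntermediateField F Ω) : IntermediateField F Ω :=
  K ⊔ sSup {L : IntermediateField F Ω | IsGaloisOfDegree p K L ∧ IsGalois F L}

variable (F Ω)

/-- The fields `F^{n}`, for `n ≥ 2`, with `F^{2} = F^(2)`; for `n < 2` the value is `F`. -/
def curlyField : ℕ → IntermediateField F Ω
  | 0 => ⊥
  | 1 => ⊥
  | 2 => kummerExt p F Ω
  | n + 3 => curlyStep p (curlyField (n + 2))

/-- The fields `F^(n)`, for `n ≥ 2`; for `n < 2` the value is `F`. -/
def roundField : ℕ → IntermediateField F Ω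
  | 0 => ⊥
  | 1 => ⊥
  | 2 => kummerExt p F Ω
  | n + 3 => roundStep p (roundField (n + 2))

end Towers

end RigidField

end

/-! Both directions go through one condition on K = F^(2): every σ in Gal(Ω/F) acts trivially on K
modulo p-th powers (`ActsTrivially`). By Kummer theory the Galois extensions of degree p of K are
the fields K(l) with l ^ p in K and l not in K. If σ(l ^ p) / l ^ p is always a p-th power in K,
then every conjugate of l lies in K(l), so K(l) is Galois over F and the two compositums agree.

Suppose F is p-rigid. The norm of 1 - a^(1/p) is 1 - a, so 1 - a is a power of a modulo p-th powers
whenever a is not a p-th power (`IsSteinbergRigid`). This relation alone produces a valuation ring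
whose principal units are p-th powers and whose units are cyclic modulo p-th powers
(`IsSteinbergRigid.exists_isRigidValuation`). Such a ring can be followed through a Kummer extension
E = F(α): it yields the same property for E, and every nonzero element of E has the form α ^ k * c *
e ^ p with c in F (`isSteinbergRigid_and_exists_eq`). Repeating this over finite sets of roots gives
the Steinberg property for the field K' generated by all p-th roots over K, and shows that each
nonzero element of K' is r * e ^ p with r ^ p in K. Trivial action therefore passes from K to K'
(`ActsTrivially.pRootExtension`), and an induction starting from F gives F^{n} = F^(n) for all n ≥
2.

Conversely, let K = F^(2) and F^(3) = F^{3}. If L/K is Galois of degree p and L/F is Galois, then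
Gal(L/K) is central in Gal(L/F) (`commute_on_generator`). Hence for every p-th root l of an element
of K, the quotient σ l / l is fixed by Gal(Ω/K), and the action on K modulo p-th powers is trivial.
For x in E = F(a^(1/p)) this makes the successive quotients σ^i x / x so regular that the norm of x
becomes a p-th power in E; Kummer theory then places it in some a ^ k F^p
(`isPRigid_of_actsTrivially`). -/

namespace RigidField

/-! ### Steinberg maps: the exceptional classes lie on a line -/

section Classes

/-- A logarithmic map `cl` from the nonzero elements of a field to a `ZMod p`-module such that
`cl (1 - x)` is a multiple of `cl x` whenever `cl x ≠ 0`. -/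
structure IsSteinbergMap (p : ℕ) {F V : Type*} [Field F] [AddCommGroup V] [Module (ZMod p) V]
    (cl : F → V) : Prop where
  map_mul : ∀ {x y : F}, x ≠ 0 → y ≠ 0 → cl (x * y) = cl x + cl y
  map_neg_one : cl (-1) = 0
  map_one_sub : ∀ {x : F}, x ≠ 0 → cl x ≠ 0 → ∃ k : ZMod p, cl (1 - x) = k • cl x

variable {p : ℕ} {F V : Type*} [Field F] [AddCommGroup V] [Module (ZMod p) V] {cl : F → V}

namespace IsSteinbergMap

lemma map_one (h : IsSteinbergMap p cl) : cl 1 = 0 := by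
  have := h.map_mul (one_ne_zero (α := F)) one_ne_zero
  simpa using this

lemma map_inv (h : IsSteinbergMap p cl) {x : F} (hx : x ≠ 0) : cl x⁻¹ = -cl x := by
  have := h.map_mul hx (inv_ne_zero hx)
  rw [mul_inv_cancel₀ hx, h.map_one] at this
  exact (neg_eq_of_add_eq_zero_right this.symm).symm

lemma map_div (h : IsSteinbergMap p cl) {x y : F} (hx : x ≠ 0) (hy : y ≠ 0) :
    cl (x / y) = cl x - cl y := by
  rw [div_eq_mul_inv, h.map_mul hx (inv_ne_zero hy), h.map_inv hy, sub_eq_add_neg]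

lemma map_neg (h : IsSteinbergMap p cl) {x : F} (hx : x ≠ 0) : cl (-x) = cl x := by
  rw [← neg_one_mul, h.map_mul (neg_ne_zero.2 one_ne_zero) hx, h.map_neg_one, zero_add]

lemma map_sub (h : IsSteinbergMap p cl) {x y : F} (hx : x ≠ 0) (hy : y ≠ 0) (hxy : cl x ≠ cl y) :
    ∃ t : ZMod p, cl (x - y) = cl x + t • (cl y - cl x) := by
  have h1 : cl (y / x) = cl y - cl x := h.map_div hy hx
  obtain ⟨t, ht⟩ := h.map_one_sub (div_ne_zero hy hx)
    (by rw [h1]; exact sub_ne_zero.2 hxy.symm)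
  have h2 : 1 - y / x ≠ 0 := by
    intro h0
    rw [sub_eq_zero] at h0
    rw [← h0, h.map_one] at h1
    exact hxy (sub_eq_zero.1 h1.symm).symm
  refine ⟨t, ?_⟩
  rw [← h1, ← ht, ← h.map_mul hx h2]
  congr 1
  field_simp

end IsSteinbergMap

/-- The element `x` satisfies `cl (1 - x) = (1 - μ)⁻¹ • cl x` with `μ ≠ 0, 1`. -/
def IsExceptional (cl : F → V) (x : F) (μ : ZMod p) : Prop :=
  x ≠ 0 ∧ μ ≠ 0 ∧ μ ≠ 1 ∧ (1 - μ) • cl (1 - x) = cl x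

variable [Fact p.Prime]

/-- Writing the coefficient of `cl (1 - x)` as `(1 - μ)⁻¹` makes the parameter multiplicative. The
class of y - x = (1 - x) - (1 - y) lies both on the affine line through `cl x` and `cl y` and on the
one through `cl (1 - x)` and `cl (1 - y)`. Comparing coordinates in the independent pair `cl x`, `cl
y` determines the intersection point. -/
lemma IsExceptional.div (h : IsSteinbergMap p cl) {x y : F} {μ ν : ZMod p}
    (hx : IsExceptional cl x μ) (hy : IsExceptional cl y ν)
    (hind : LinearIndependent (ZMod p) ![cl x, cl y]) : IsExceptional cl (x / y) (μ / ν) := by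
  obtain ⟨hx0, hμ0, hμ1, hxμ⟩ := hx
  obtain ⟨hy0, hν0, hν1, hyν⟩ := hy
  rw [LinearIndependent.pair_iff] at hind
  have hclx : cl x ≠ 0 := fun h0 => one_ne_zero (hind 1 0 (by simp [h0])).1
  have hcly : cl y ≠ 0 := fun h0 => one_ne_zero (hind 0 1 (by simp [h0])).2
  have hne : cl x ≠ cl y := fun h0 => one_ne_zero (hind 1 (-1) (by rw [h0]; module)).1
  have hμ' : (1 - μ) ≠ 0 := sub_ne_zero.2 hμ1.symm
  have hν' : (1 - ν) ≠ 0 := sub_ne_zero.2 hν1.symm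
  have hx1 : 1 - x ≠ 0 := fun h0 => hclx (by rw [← sub_eq_zero.1 h0, h.map_one])
  have hy1 : 1 - y ≠ 0 := fun h0 => hcly (by rw [← sub_eq_zero.1 h0, h.map_one])
  have hne1 : cl (1 - x) ≠ cl (1 - y) := by
    intro h0
    have : (1 - ν) • cl x + (-(1 - μ)) • cl y = 0 := by
      rw [← hxμ, ← hyν, h0]; module
    exact hν' (hind _ _ this).1
  obtain ⟨t, ht⟩ := h.map_one_sub (div_ne_zero hx0 hy0)
    (by rw [h.map_div hx0 hy0]; exact sub_ne_zero.2 hne)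
  obtain ⟨s, hs⟩ := h.map_sub hx1 hy1 hne1
  have h1 : 1 - x / y ≠ 0 := by
    intro h0
    rw [sub_eq_zero, eq_comm, div_eq_one_iff_eq hy0] at h0
    exact hne (by rw [h0])
  have h2 : cl (1 - x - (1 - y)) = cl y + cl (1 - x / y) := by
    rw [← h.map_mul hy0 h1]; congr 1; field_simp; ring
  rw [h2, ht, h.map_div hx0 hy0] at hs
  have hA : cl (1 - x) = (1 - μ)⁻¹ • cl x := by rw [← hxμ, smul_smul, inv_mul_cancel₀ hμ', one_smul]
  have hB : cl (1 - y) = (1 - ν)⁻¹ • cl y := by rw [← hyν, smul_smul, inv_mul_cancel₀ hν', one_smul]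
  rw [hA, hB] at hs
  have h3 : (t - (1 - s) * (1 - μ)⁻¹) • cl x + (1 - t - s * (1 - ν)⁻¹) • cl y = 0 := by
    linear_combination (norm := module) hs
  obtain ⟨e1, e2⟩ := hind _ _ h3
  have e1' : t * (1 - μ) = 1 - s := by
    rw [sub_eq_zero.1 e1]; field_simp
  have e2' : (1 - t) * (1 - ν) = s := by
    rw [sub_eq_zero.1 e2]; field_simp
  have key : t * (ν - μ) = ν := by linear_combination e1' + e2'
  have hνμ : ν - μ ≠ 0 := fun h0 => hν0 (by rw [← key, h0, mul_zero])
  refine ⟨div_ne_zero hx0 hy0, div_ne_zero hμ0 hν0, ?_, ?_⟩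
  · intro h0
    rw [div_eq_one_iff_eq hν0] at h0
    exact hνμ (by rw [h0, sub_self])
  · rw [ht, smul_smul]
    have : (1 - μ / ν) * t = 1 := by
      field_simp
      linear_combination key
    rw [this, one_smul]

/-- Dividing x by y repeatedly, p - 1 times, multiplies the parameter by ν ^ -(p - 1) = 1, while the
class becomes `cl x + cl y`. One more division, by x, gives parameter μ / μ = 1, which is excluded.
-/
lemma IsExceptional.not_linearIndependent (h : IsSteinbergMap p cl) {x y : F} {μ ν : ZMod p}
    (hx : IsExceptional cl x μ) (hy : IsExceptional cl y ν) :
    ¬ LinearIndependent (ZMod p) ![cl x, cl y] := by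
  intro hind
  have hind' := LinearIndependent.pair_iff.1 hind
  have key : ∀ j : ℕ, IsExceptional cl (x / y ^ j) (μ / ν ^ j) ∧
      cl (x / y ^ j) = cl x - (j : ZMod p) • cl y := by
    intro j
    induction j with
    | zero => simpa using hx
    | succ j ih =>
      obtain ⟨h1, h2⟩ := ih
      have h3 : x / y ^ (j + 1) = x / y ^ j / y := by rw [pow_succ, div_div]
      have h4 : μ / ν ^ (j + 1) = μ / ν ^ j / ν := by rw [pow_succ, div_div]
      refine ⟨?_, ?_⟩
      · rw [h3, h4]
        refine h1.div h hy ?_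
        rw [LinearIndependent.pair_iff]
        intro a b hab
        rw [h2] at hab
        have := hind' a (b - a * j) (by linear_combination (norm := module) hab)
        obtain ⟨ha, hb⟩ := this
        refine ⟨ha, ?_⟩
        simpa [ha] using hb
      · rw [h3, h.map_div h1.1 hy.1, h2]
        push_cast
        module
  obtain ⟨h1, h2⟩ := key (p - 1)
  rw [ZMod.pow_card_sub_one_eq_one hy.2.1, div_one] at h1
  have hp : 1 ≤ p := (Fact.out : p.Prime).one_lt.le
  have hc : cl (x / y ^ (p - 1)) = cl x + cl y := by
    rw [h2]; push_cast [hp]; simp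
  have := h1.div h hx (by
    rw [hc, LinearIndependent.pair_iff]
    intro a b hab
    obtain ⟨e1, e2⟩ := hind' (a + b) a (by linear_combination (norm := module) hab)
    subst e2
    simpa using e1)
  exact this.2.2.1 (div_self hx.2.1)

/-- Outside of a line, `cl (1 - x)` is either `0` or `cl x`. -/
lemma IsSteinbergMap.exists_span_singleton (h : IsSteinbergMap p cl) :
    ∃ v : V, ∀ x : F, x ≠ 0 → cl x ∉ Submodule.span (ZMod p) {v} →
      cl (1 - x) = 0 ∨ cl (1 - x) = cl x := by
  by_cases hex : ∃ (x : F) (μ : ZMod p), cl x ≠ 0 ∧ IsExceptional cl x μ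
  · obtain ⟨x, μ, hx0, hx⟩ := hex
    refine ⟨cl x, fun y hy0 hy => ?_⟩
    have hcy : cl y ≠ 0 := fun h0 => hy (by rw [h0]; exact zero_mem _)
    obtain ⟨k, hk⟩ := h.map_one_sub hy0 hcy
    by_contra! hcon
    have hk0 : k ≠ 0 := by rintro rfl; exact hcon.1 (by rw [hk, zero_smul])
    have hk1 : k ≠ 1 := by rintro rfl; exact hcon.2 (by rw [hk, one_smul])
    -- The parameter is the solution μ of k = (1 - μ)⁻¹; k ≠ 1 makes it nonzero, and k ≠ 0 keeps it
    -- from being 1.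
    have hyex : IsExceptional cl y (1 - k⁻¹) := by
      refine ⟨hy0, ?_, ?_, ?_⟩
      · rw [sub_ne_zero]; intro h1; exact hk1 (inv_eq_one.1 h1.symm)
      · simp [hk0]
      · rw [hk, smul_smul, sub_sub_cancel, inv_mul_cancel₀ hk0, one_smul]
    refine hx.not_linearIndependent h hyex ?_
    rw [LinearIndependent.pair_iff' hx0]
    intro a ha
    exact hy (ha ▸ Submodule.smul_mem _ _ (Submodule.mem_span_singleton_self _))
  · push Not at hex
    refine ⟨0, fun y hy0 hy => ?_⟩
    have hcy : cl y ≠ 0 := fun h0 => hy (by rw [h0]; exact zero_mem _)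
    obtain ⟨k, hk⟩ := h.map_one_sub hy0 hcy
    by_contra! hcon
    have hk0 : k ≠ 0 := by rintro rfl; exact hcon.1 (by rw [hk, zero_smul])
    have hk1 : k ≠ 1 := by rintro rfl; exact hcon.2 (by rw [hk, one_smul])
    refine hex y (1 - k⁻¹) hcy ⟨hy0, ?_, ?_, ?_⟩
    · rw [sub_ne_zero]; intro h1; exact hk1 (inv_eq_one.1 h1.symm)
    · simp [hk0]
    · rw [hk, smul_smul, sub_sub_cancel, inv_mul_cancel₀ hk0, one_smul]

end Classes

/-! ### The valuation ring of a Steinberg map -/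

section Valuation

variable {p : ℕ} {F V : Type*} [Field F] [AddCommGroup V] [Module (ZMod p) V]

/-- The elements outside of `H` which will have valuation less than one. -/
def IsSmall (cl : F → V) (H : Submodule (ZMod p) V) (x : F) : Prop :=
  x ≠ 0 ∧ cl x ∉ H ∧ cl (1 - x) = 0

/-- The elements in `H` which multiply small elements to small elements. -/
def IsBounded (cl : F → V) (H : Submodule (ZMod p) V) (x : F) : Prop :=
  x ≠ 0 ∧ cl x ∈ H ∧ ∀ a, IsSmall cl H a → IsSmall cl H (x * a)

/-- The elements of the valuation ring attached to `cl` and `H`. -/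
def IsValuationInteger (cl : F → V) (H : Submodule (ZMod p) V) (x : F) : Prop :=
  x = 0 ∨ IsSmall cl H x ∨ IsBounded cl H x

variable {cl : F → V} {H : Submodule (ZMod p) V}

lemma IsSmall.class_ne_zero {x : F} (hx : IsSmall cl H x) : cl x ≠ 0 :=
  fun h0 => hx.2.1 (h0 ▸ zero_mem _)

lemma IsSmall.one_sub_ne_zero (h : IsSteinbergMap p cl) {x : F} (hx : IsSmall cl H x) :
    1 - x ≠ 0 := fun h0 => hx.class_ne_zero (by rw [← sub_eq_zero.1 h0, h.map_one])

lemma not_isSmall_inv (h : IsSteinbergMap p cl) {x : F} (hx : IsSmall cl H x) :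
    ¬ IsSmall cl H x⁻¹ := by
  intro hx'
  have h1 : 1 - x⁻¹ = -((1 - x) / x) := by
    have := hx.1
    field_simp; ring
  have h2 := hx'.2.2
  rw [h1, h.map_neg (div_ne_zero (hx.one_sub_ne_zero h) hx.1),
    h.map_div (hx.one_sub_ne_zero h) hx.1, hx.2.2, zero_sub, neg_eq_zero] at h2
  exact hx.class_ne_zero h2

variable [Fact p.Prime]

lemma two_smul_mem_iff (h2 : (2 : ZMod p) ≠ 0) {v : V} : (2 : ZMod p) • v ∈ H ↔ v ∈ H :=
  H.smul_mem_iff h2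

variable (hH : ∀ x : F, x ≠ 0 → cl x ∉ H → cl (1 - x) = 0 ∨ cl (1 - x) = cl x)

include hH in
lemma isSmall_or_inv (h : IsSteinbergMap p cl) {x : F} (hx0 : x ≠ 0) (hx : cl x ∉ H) :
    IsSmall cl H x ∨ IsSmall cl H x⁻¹ := by
  have hcx : cl x ≠ 0 := fun h0 => hx (h0 ▸ zero_mem _)
  have h10 : 1 - x ≠ 0 := fun h0 => hcx (by rw [← sub_eq_zero.1 h0, h.map_one])
  rcases hH x hx0 hx with h1 | h1
  · exact Or.inl ⟨hx0, hx, h1⟩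
  · refine Or.inr ⟨inv_ne_zero hx0, by rwa [h.map_inv hx0, neg_mem_iff], ?_⟩
    have h2 : 1 - x⁻¹ = -((1 - x) / x) := by field_simp; ring
    rw [h2, h.map_neg (div_ne_zero h10 hx0), h.map_div h10 hx0, h1, sub_self]

include hH in
-- Otherwise 1 - x² = (1 - x)(1 + x) has class `cl x`, whereas x² has class 2 `cl x` outside `H`,
-- which leaves only 0 and 2 `cl x`.
lemma IsSmall.neg (h : IsSteinbergMap p cl) (h2 : (2 : ZMod p) ≠ 0) {x : F}
    (hx : IsSmall cl H x) : IsSmall cl H (-x) := by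
  have hn : cl (-x) = cl x := h.map_neg hx.1
  refine ⟨neg_ne_zero.2 hx.1, by rw [hn]; exact hx.2.1, ?_⟩
  rcases hH (-x) (neg_ne_zero.2 hx.1) (by rw [hn]; exact hx.2.1) with h1 | h1
  · exact h1
  exfalso
  have hx1 : 1 - x ≠ 0 := hx.one_sub_ne_zero h
  have hx2 : 1 - -x ≠ 0 := fun h0 => by
    have := sub_eq_zero.1 h0
    rw [← this, h.map_one] at hn
    exact hx.class_ne_zero hn.symm
  have hsq : cl (x * x) = (2 : ZMod p) • cl x := by rw [h.map_mul hx.1 hx.1, two_smul]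
  have h3 : cl (1 - x * x) = cl x := by
    rw [show 1 - x * x = (1 - x) * (1 - -x) by ring, h.map_mul hx1 hx2, hx.2.2, h1, hn, zero_add]
  rcases hH (x * x) (mul_ne_zero hx.1 hx.1)
    (by rw [hsq, two_smul_mem_iff h2]; exact hx.2.1) with h4 | h4
  · exact hx.class_ne_zero (h3.symm.trans h4)
  · rw [h3, hsq, two_smul] at h4
    exact hx.class_ne_zero (by simpa using h4)

omit [Fact p.Prime] in
include hH in
-- The identity 1 - xy = (1 - x)(1 - z) with z = -x(1 - y)/(1 - x) reduces to the dichotomy for z,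
-- whose class is that of x.
lemma IsSmall.class_one_sub_mul_of (h : IsSteinbergMap p cl) {x y : F} (hx : IsSmall cl H x)
    (hy : IsSmall cl H y) :
    1 - x * y ≠ 0 ∧ (cl (1 - x * y) = 0 ∨ cl (1 - x * y) = cl x) := by
  have hx1 := hx.one_sub_ne_zero h
  have hy1 := hy.one_sub_ne_zero h
  set z := -(x * (1 - y) / (1 - x)) with hz
  have hz0 : z ≠ 0 := neg_ne_zero.2 (div_ne_zero (mul_ne_zero hx.1 hy1) hx1)
  have hcz : cl z = cl x := by
    rw [hz, h.map_neg (div_ne_zero (mul_ne_zero hx.1 hy1) hx1),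
      h.map_div (mul_ne_zero hx.1 hy1) hx1, h.map_mul hx.1 hy1, hx.2.2, hy.2.2]
    simp
  have h1 : 1 - x * y = (1 - x) * (1 - z) := by rw [hz]; field_simp; ring
  have hz1 : 1 - z ≠ 0 := fun h0 => by
    rw [← sub_eq_zero.1 h0, h.map_one] at hcz
    exact hx.class_ne_zero hcz.symm
  refine ⟨h1 ▸ mul_ne_zero hx1 hz1, ?_⟩
  rw [h1, h.map_mul hx1 hz1, hx.2.2, zero_add, ← hcz]
  exact hH z hz0 (hcz ▸ hx.2.1)

include hH in
-- By symmetry a nonzero class of 1 - xy would equal both `cl x` and `cl y`. Then xy has class 2 `cl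
-- x` outside `H`, and the dichotomy for xy is violated.
lemma IsSmall.class_one_sub_mul (h : IsSteinbergMap p cl) (h2 : (2 : ZMod p) ≠ 0) {x y : F}
    (hx : IsSmall cl H x) (hy : IsSmall cl H y) : cl (1 - x * y) = 0 := by
  rcases (hx.class_one_sub_mul_of hH h hy).2 with h1 | h1
  · exact h1
  have h3 := (hy.class_one_sub_mul_of hH h hx).2
  rw [mul_comm y x] at h3
  rcases h3 with h3 | h3
  · exact h3
  exfalso
  have hxy : cl (x * y) = (2 : ZMod p) • cl x := by
    rw [h.map_mul hx.1 hy.1, two_smul, ← h1, h3, ← h3, h1]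
  rcases hH (x * y) (mul_ne_zero hx.1 hy.1)
    (by rw [hxy, two_smul_mem_iff h2]; exact hx.2.1) with h4 | h4
  · exact hx.class_ne_zero (h1.symm.trans h4)
  · rw [h1, hxy, two_smul] at h4
    exact hx.class_ne_zero (by simpa using h4)

include hH in
lemma IsSmall.mul (h : IsSteinbergMap p cl) (h2 : (2 : ZMod p) ≠ 0) {x y : F}
    (hx : IsSmall cl H x) (hy : IsSmall cl H y) (hxy : cl (x * y) ∉ H) : IsSmall cl H (x * y) :=
  ⟨mul_ne_zero hx.1 hy.1, hxy, hx.class_one_sub_mul hH h h2 hy⟩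

include hH in
-- For small z, group xyz as x(yz) or y(xz). One of yz, xz has class outside `H`: if both were
-- inside, then 2 `cl x` = `cl (xy)` + `cl (xz)` - `cl (yz)` would be in `H`.
lemma IsSmall.mul_isBounded (h : IsSteinbergMap p cl) (h2 : (2 : ZMod p) ≠ 0) {x y : F}
    (hx : IsSmall cl H x) (hy : IsSmall cl H y) (hxy : cl (x * y) ∈ H) :
    IsBounded cl H (x * y) := by
  refine ⟨mul_ne_zero hx.1 hy.1, hxy, fun z hz => ?_⟩
  have hxyz : cl (x * y * z) ∉ H := by
    rw [h.map_mul (mul_ne_zero hx.1 hy.1) hz.1, H.add_mem_iff_right hxy]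
    exact hz.2.1
  by_cases hyz : cl (y * z) ∈ H
  · by_cases hxz : cl (x * z) ∈ H
    · exfalso
      apply hx.2.1
      rw [← two_smul_mem_iff h2]
      rw [h.map_mul hx.1 hz.1] at hxz
      rw [h.map_mul hy.1 hz.1] at hyz
      rw [h.map_mul hx.1 hy.1] at hxy
      convert H.sub_mem (H.add_mem hxy hxz) hyz using 1
      module
    · have e : x * y * z = y * (x * z) := by ring
      rw [e] at hxyz ⊢
      exact hy.mul hH h h2 (hx.mul hH h h2 hz hxz) hxyz
  · rw [mul_assoc] at hxyz ⊢
    exact hx.mul hH h h2 (hy.mul hH h h2 hz hyz) hxyz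

include hH in
lemma IsValuationInteger.mul (h : IsSteinbergMap p cl) (h2 : (2 : ZMod p) ≠ 0) {x y : F}
    (hx : IsValuationInteger cl H x) (hy : IsValuationInteger cl H y) :
    IsValuationInteger cl H (x * y) := by
  rcases hx with rfl | hx | hx
  · left; simp
  · rcases hy with rfl | hy | hy
    · left; simp
    · by_cases hxy : cl (x * y) ∈ H
      · exact Or.inr (Or.inr (hx.mul_isBounded hH h h2 hy hxy))
      · exact Or.inr (Or.inl (hx.mul hH h h2 hy hxy))
    · rw [mul_comm]; exact Or.inr (Or.inl (hy.2.2 x hx))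
  · rcases hy with rfl | hy | hy
    · left; simp
    · exact Or.inr (Or.inl (hx.2.2 y hy))
    · refine Or.inr (Or.inr ⟨mul_ne_zero hx.1 hy.1, ?_, fun a ha => ?_⟩)
      · rw [h.map_mul hx.1 hy.1]; exact H.add_mem hx.2.1 hy.2.1
      · rw [mul_assoc]; exact hx.2.2 _ (hy.2.2 _ ha)

include hH in
/-- If `x ∈ H` and `x * a` is not small for a small `a`, then `x⁻¹` is `a` times a small element. -/
lemma isSmall_inv_mul (h : IsSteinbergMap p cl) {x a : F} (hx0 : x ≠ 0)
    (hx : cl x ∈ H) (ha : IsSmall cl H a) (hxa : ¬ IsSmall cl H (x * a)) :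
    IsSmall cl H (x * a)⁻¹ := by
  refine (isSmall_or_inv hH h (mul_ne_zero hx0 ha.1) ?_).resolve_left hxa
  rw [h.map_mul hx0 ha.1, H.add_mem_iff_right hx]
  exact ha.2.1

include hH in
lemma isValuationInteger_or_inv (h : IsSteinbergMap p cl) (h2 : (2 : ZMod p) ≠ 0) {x : F}
    (hx0 : x ≠ 0) : IsValuationInteger cl H x ∨ IsValuationInteger cl H x⁻¹ := by
  by_cases hx : cl x ∈ H
  · by_cases hb : IsBounded cl H x
    · exact Or.inl (Or.inr (Or.inr hb))
    have : ∃ a, IsSmall cl H a ∧ ¬ IsSmall cl H (x * a) := by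
      by_contra! hcon
      exact hb ⟨hx0, hx, hcon⟩
    obtain ⟨a, ha, hxa⟩ := this
    have h3 := isSmall_inv_mul hH h hx0 hx ha hxa
    right
    have h4 : x⁻¹ = (x * a)⁻¹ * a := by have := ha.1; field_simp
    rw [h4]
    exact IsValuationInteger.mul hH h h2 (Or.inr (Or.inl h3)) (Or.inr (Or.inl ha))
  · rcases isSmall_or_inv hH h hx0 hx with h1 | h1
    · exact Or.inl (Or.inr (Or.inl h1))
    · exact Or.inr (Or.inr (Or.inl h1))

include hH in
-- If (1 - x)y were not small for a small y, its inverse would be. The product of that inverse with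
-- y is 1/(1 - x), and 1 - 1/(1 - x) = -x/(1 - x) has the nonzero class `cl x`.
lemma IsSmall.one_sub (h : IsSteinbergMap p cl) (h2 : (2 : ZMod p) ≠ 0) {x : F}
    (hx : IsSmall cl H x) : IsBounded cl H (1 - x) := by
  have hx1 := hx.one_sub_ne_zero h
  refine ⟨hx1, by rw [hx.2.2]; exact zero_mem _, fun y hy => ?_⟩
  by_contra hcon
  have h3 := isSmall_inv_mul hH h hx1 (by rw [hx.2.2]; exact zero_mem _) hy hcon
  have h4 := hy.class_one_sub_mul hH h h2 h3
  have h5 : 1 - y * ((1 - x) * y)⁻¹ = -(x / (1 - x)) := by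
    have := hy.1
    field_simp; ring
  rw [h5, h.map_neg (div_ne_zero hx.1 hx1), h.map_div hx.1 hx1, hx.2.2, sub_zero] at h4
  exact hx.class_ne_zero h4

include hH in
-- Since (1 - x)⁻¹ = 1 + x/(1 - x), it is enough that x/(1 - x) is small. If instead its inverse
-- were small, 1 + (1 - x)/x = x⁻¹ would have class 0.
lemma IsSmall.one_sub_inv (h : IsSteinbergMap p cl) (h2 : (2 : ZMod p) ≠ 0) {x : F}
    (hx : IsSmall cl H x) : IsBounded cl H (1 - x)⁻¹ := by
  have hx1 := hx.one_sub_ne_zero h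
  have hx0 := hx.1
  have hq : cl (x / (1 - x)) ∉ H := by
    rw [h.map_div hx.1 hx1, hx.2.2, sub_zero]; exact hx.2.1
  rcases isSmall_or_inv hH h (div_ne_zero hx.1 hx1) hq with h1 | h1
  · have := (h1.neg hH h h2).one_sub hH h h2
    convert this using 1
    field_simp; ring
  · exfalso
    have h3 := (h1.neg hH h h2).2.2
    rw [show 1 - -(x / (1 - x))⁻¹ = x⁻¹ by field_simp; ring, h.map_inv hx.1, neg_eq_zero] at h3
    exact hx.class_ne_zero h3

include hH in
lemma IsSmall.one_sub_sub (h : IsSteinbergMap p cl) (h2 : (2 : ZMod p) ≠ 0) {a b : F}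
    (ha : IsSmall cl H a) (hb : IsSmall cl H b) : 1 - a - b ≠ 0 ∧ cl (1 - a - b) = 0 := by
  have ha1 := ha.one_sub_ne_zero h
  have hc := (ha.one_sub_inv hH h h2).2.2 b hb
  have h3 : 1 - a - b = (1 - a) * (1 - (1 - a)⁻¹ * b) := by field_simp
  have h4 := hc.one_sub_ne_zero h
  rw [h3]
  exact ⟨mul_ne_zero ha1 h4, by rw [h.map_mul ha1 h4, ha.2.2, hc.2.2, add_zero]⟩

include hH in
-- For bounded x everything rests on 1 - (1 + x)z = 1 - z - xz with z and xz small: this has class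
-- 0, and it is nonzero, so z = (1 + x)⁻¹ cannot be small.
lemma IsValuationInteger.one_add (h : IsSteinbergMap p cl) (h2 : (2 : ZMod p) ≠ 0) {x : F}
    (hx : IsValuationInteger cl H x) : IsValuationInteger cl H (1 + x) := by
  have hone : IsBounded cl H (1 : F) :=
    ⟨one_ne_zero, by rw [h.map_one]; exact zero_mem _, fun a ha => by rwa [one_mul]⟩
  rcases hx with rfl | hx | hx
  · rw [add_zero]; exact Or.inr (Or.inr hone)
  · have := (hx.neg hH h h2).one_sub hH h h2
    rw [sub_neg_eq_add] at this
    exact Or.inr (Or.inr this)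
  · by_cases h0 : 1 + x = 0
    · exact Or.inl h0
    by_cases hc : cl (1 + x) ∈ H
    · refine Or.inr (Or.inr ⟨h0, hc, fun z hz => ⟨mul_ne_zero h0 hz.1, ?_, ?_⟩⟩)
      · rw [h.map_mul h0 hz.1, H.add_mem_iff_right hc]; exact hz.2.1
      · rw [show 1 - (1 + x) * z = 1 - z - x * z by ring]
        exact (hz.one_sub_sub hH h h2 (hx.2.2 z hz)).2
    · rcases isSmall_or_inv hH h h0 hc with h1 | h1
      · exact Or.inr (Or.inl h1)
      · exfalso
        refine (h1.one_sub_sub hH h h2 (hx.2.2 _ h1)).1 ?_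
        field_simp
        ring

include hH in
lemma IsValuationInteger.add (h : IsSteinbergMap p cl) (h2 : (2 : ZMod p) ≠ 0) {x y : F}
    (hx : IsValuationInteger cl H x) (hy : IsValuationInteger cl H y) :
    IsValuationInteger cl H (x + y) := by
  by_cases hx0 : x = 0
  · rwa [hx0, zero_add]
  by_cases hy0 : y = 0
  · rwa [hy0, add_zero]
  rcases isValuationInteger_or_inv hH h h2 (div_ne_zero hx0 hy0) with h1 | h1
  · have := hy.mul hH h h2 (h1.one_add hH h h2)
    convert this using 1
    field_simp; ring
  · have := hx.mul hH h h2 (h1.one_add hH h h2)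
    convert this using 1
    field_simp

/-- The valuation ring attached to `cl` and `H`. -/
def steinbergValuationSubring (h : IsSteinbergMap p cl) (h2 : (2 : ZMod p) ≠ 0) :
    ValuationSubring F where
  carrier := {x | IsValuationInteger cl H x}
  mul_mem' := IsValuationInteger.mul hH h h2
  one_mem' := Or.inr (Or.inr
    ⟨one_ne_zero, by rw [h.map_one]; exact zero_mem _, fun a ha => by rwa [one_mul]⟩)
  add_mem' := IsValuationInteger.add hH h h2
  zero_mem' := Or.inl rfl
  neg_mem' := by
    intro x hx
    have : IsValuationInteger cl H (-1 : F) := Or.inr (Or.inr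
      ⟨neg_ne_zero.2 one_ne_zero, by rw [h.map_neg_one]; exact zero_mem _, fun a ha => by
        rw [neg_one_mul]; exact ha.neg hH h h2⟩)
    have := this.mul hH h h2 hx
    rwa [neg_one_mul] at this
  mem_or_inv_mem' := by
    intro x
    by_cases hx : x = 0
    · exact Or.inl (Or.inl hx)
    · exact isValuationInteger_or_inv hH h h2 hx

/-- A Steinberg map is trivial on the principal units of some valuation ring, and its values on the
units of that ring lie on a line. -/
theorem IsSteinbergMap.exists_valuationSubring (h : IsSteinbergMap p cl) (h2 : (2 : ZMod p) ≠ 0) :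
    ∃ (O : ValuationSubring F) (v : V),
      (∀ x : F, O.valuation x < 1 → cl (1 + x) = 0) ∧
      ∀ x : F, O.valuation x = 1 → cl x ∈ Submodule.span (ZMod p) {v} := by
  obtain ⟨v, hv⟩ := h.exists_span_singleton
  set H := Submodule.span (ZMod p) {v}
  let O := steinbergValuationSubring hv h h2
  have hO : ∀ x, O.valuation x ≤ 1 ↔ IsValuationInteger cl H x := fun x =>
    O.valuation_le_one_iff x
  refine ⟨O, v, fun x hx => ?_, fun x hx => ?_⟩
  · rw [← sub_neg_eq_add]
    rw [← Valuation.map_neg] at hx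
    generalize -x = y at hx
    by_cases hy0 : y = 0
    · rw [hy0, sub_zero, h.map_one]
    have hy := (hO y).1 hx.le
    have hyi : ¬ IsValuationInteger cl H y⁻¹ := by
      rw [← hO, map_inv₀, not_le]
      exact (one_lt_inv₀ (by simpa [zero_lt_iff] using hy0)).2 hx
    rcases hy with hy | hy | hy
    · exact absurd hy hy0
    · exact hy.2.2
    · have hyH : cl y⁻¹ ∈ H := by rw [h.map_inv hy0]; exact H.neg_mem hy.2.1
      -- As y⁻¹ is not an integer, some small a has y⁻¹a not small. Then y = (y/a) · a is a product
      -- of two small elements, so 1 - y has class 0.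
      have : ∃ a, IsSmall cl H a ∧ ¬ IsSmall cl H (y⁻¹ * a) := by
        by_contra! hcon
        exact hyi (Or.inr (Or.inr ⟨inv_ne_zero hy0, hyH, hcon⟩))
      obtain ⟨a, ha, hya⟩ := this
      have h3 := isSmall_inv_mul hv h (inv_ne_zero hy0) hyH ha hya
      have h4 := h3.class_one_sub_mul hv h h2 ha
      convert h4 using 3
      have := ha.1
      field_simp
  · have hx0 : x ≠ 0 := by rintro rfl; simp at hx
    have h1 := (hO x).1 hx.le
    have h3 := (hO x⁻¹).1 (by rw [map_inv₀, hx, inv_one])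
    rcases h1 with h1 | h1 | h1
    · exact absurd h1 hx0
    · rcases h3 with h3 | h3 | h3
      · exact absurd h3 (inv_ne_zero hx0)
      · exact absurd h3 (not_isSmall_inv h h1)
      · exact absurd h3.2.1 (by rw [h.map_inv hx0, neg_mem_iff]; exact h1.2.1)
    · exact h1.2.1

end Valuation

noncomputable section

/-! ### Rigidity in terms of p-th power classes and valuation rings -/

section PowerClasses

/-- `1 - x` is a power of `x` modulo `p`-th powers, for every `x` which is not a `p`-th power. -/
def IsSteinbergRigid (p : ℕ) (F : Type*) [Field F] : Prop :=
  ∀ x : F, (∀ c : F, c ^ p ≠ x) → ∃ (k : ℕ) (c : F), 1 - x = x ^ k * c ^ p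

/-- The principal units of `O` are `p`-th powers, and the units of `O` are cyclic modulo
`p`-th powers. -/
structure IsRigidValuation (p : ℕ) {F : Type*} [Field F] (O : ValuationSubring F) : Prop where
  principal : ∀ x : F, O.valuation x < 1 → ∃ c : F, c ^ p = 1 + x
  cyclic : ∀ x y : F, O.valuation x = 1 → O.valuation y = 1 → (∀ c : F, c ^ p ≠ x) →
    ∃ (k : ℕ) (c : F), y = x ^ k * c ^ p

/-- Compare the value of x with 1. Below, 1 - x is a principal unit; above, 1 - x = -x(1 - x⁻¹) and
-1 is a p-th power. For a unit x, either 1 - x is a unit and cyclicity applies, or x is a principal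
unit and hence a p-th power. -/
lemma IsRigidValuation.isSteinbergRigid {p : ℕ} (hodd : Odd p) {F : Type*} [Field F]
    {O : ValuationSubring F} (h : IsRigidValuation p O) : IsSteinbergRigid p F := by
  intro x hx
  have hx0 : x ≠ 0 := fun h0 => hx 0 (by rw [h0, zero_pow hodd.pos.ne'])
  rcases lt_trichotomy (O.valuation x) 1 with h1 | h1 | h1
  · obtain ⟨c, hc⟩ := h.principal (-x) (by rwa [Valuation.map_neg])
    exact ⟨0, c, by rw [hc]; ring⟩
  · have h2 : O.valuation (1 - x) ≤ 1 :=
      (Valuation.map_sub _ _ _).trans (by simp [h1])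
    rcases h2.lt_or_eq with h2 | h2
    · obtain ⟨c, hc⟩ := h.principal (-(1 - x)) (by rwa [Valuation.map_neg])
      exact absurd (by rw [hc]; ring) (hx c)
    · exact h.cyclic x (1 - x) h1 h2 hx
  · obtain ⟨c, hc⟩ := h.principal (-x⁻¹) (by
      rw [Valuation.map_neg, map_inv₀]; exact inv_lt_one_of_one_lt₀ h1)
    refine ⟨1, -c, ?_⟩
    rw [hodd.neg_pow, hc]
    field_simp
    ring

/-- The group of nonzero elements modulo `p`-th powers, written additively. -/
def PowerClass (p : ℕ) (F : Type*) [Field F] : Type _ :=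
  Additive (Fˣ ⧸ (powMonoidHom p : Fˣ →* Fˣ).range)

instance (p : ℕ) (F : Type*) [Field F] : AddCommGroup (PowerClass p F) :=
  inferInstanceAs (AddCommGroup (Additive (Fˣ ⧸ (powMonoidHom p : Fˣ →* Fˣ).range)))

/-- The class of a unit modulo `p`-th powers. -/
def unitPowerClass (p : ℕ) (F : Type*) [Field F] : Additive Fˣ →+ PowerClass p F :=
  (QuotientGroup.mk' (powMonoidHom p : Fˣ →* Fˣ).range).toAdditive

lemma unitPowerClass_eq_zero_iff {p : ℕ} {F : Type*} [Field F] (u : Additive Fˣ) :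
    unitPowerClass p F u = 0 ↔ ∃ w : Fˣ, w ^ p = u.toMul :=
  QuotientGroup.eq_one_iff u.toMul

instance (p : ℕ) (F : Type*) [Field F] : Module (ZMod p) (PowerClass p F) :=
  AddCommGroup.zmodModule (n := p) (by
    intro x
    obtain ⟨u, rfl⟩ : ∃ u, unitPowerClass p F u = x :=
      QuotientGroup.mk_surjective (s := (powMonoidHom p : Fˣ →* Fˣ).range) x
    rw [← map_nsmul, unitPowerClass_eq_zero_iff]
    exact ⟨u.toMul, rfl⟩)

open Classical in
/-- The class of an element modulo `p`-th powers (zero for the zero element). -/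
def powerClass (p : ℕ) {F : Type*} [Field F] (x : F) : PowerClass p F :=
  if h : x = 0 then 0 else unitPowerClass p F (Additive.ofMul (Units.mk0 x h))

variable {p : ℕ} {F : Type*} [Field F]

lemma powerClass_mul {x y : F} (hx : x ≠ 0) (hy : y ≠ 0) :
    powerClass p (x * y) = powerClass p x + powerClass p y := by
  rw [powerClass, powerClass, powerClass, dif_neg hx, dif_neg hy, dif_neg (mul_ne_zero hx hy),
    Units.mk0_mul, ofMul_mul, map_add]

lemma powerClass_one : powerClass p (1 : F) = 0 := by
  have := powerClass_mul (p := p) (one_ne_zero (α := F)) one_ne_zero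
  simpa using this

lemma powerClass_pow {x : F} (hx : x ≠ 0) (k : ℕ) :
    powerClass p (x ^ k) = (k : ZMod p) • powerClass p x := by
  induction k with
  | zero => simp [powerClass_one]
  | succ k ih => rw [pow_succ, powerClass_mul (pow_ne_zero _ hx) hx, ih]; push_cast; module

lemma powerClass_eq_zero_iff {x : F} (hx : x ≠ 0) : powerClass p x = 0 ↔ ∃ c : F, c ^ p = x := by
  rw [powerClass, dif_neg hx, unitPowerClass_eq_zero_iff, toMul_ofMul]
  constructor
  · rintro ⟨u, hu⟩
    exact ⟨u, by simpa using congrArg Units.val hu⟩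
  · rintro ⟨c, hc⟩
    rcases eq_or_ne p 0 with rfl | hp
    · refine ⟨1, ?_⟩
      ext; simpa using hc
    have hc0 : c ≠ 0 := by rintro rfl; rw [zero_pow hp] at hc; exact hx hc.symm
    exact ⟨Units.mk0 c hc0, by ext; simpa using hc⟩

lemma exists_eq_pow_mul_pow [NeZero p] {x y : F} (hx : x ≠ 0) (hy : y ≠ 0) {k : ZMod p}
    (h : powerClass p y = k • powerClass p x) : ∃ (n : ℕ) (c : F), y = x ^ n * c ^ p := by
  have hxk : x ^ k.val ≠ 0 := pow_ne_zero _ hx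
  have hd : y / x ^ k.val ≠ 0 := div_ne_zero hy hxk
  have h1 := powerClass_mul (p := p) hd hxk
  rw [div_mul_cancel₀ _ hxk, powerClass_pow hx, ZMod.natCast_zmod_val, h] at h1
  obtain ⟨c, hc⟩ := (powerClass_eq_zero_iff hd).1 (by simpa using h1)
  exact ⟨k.val, c, by rw [hc]; field_simp⟩

lemma IsSteinbergRigid.isSteinbergMap (hodd : Odd p) (h : IsSteinbergRigid p F) :
    IsSteinbergMap p (powerClass p : F → PowerClass p F) where
  map_mul := powerClass_mul
  map_neg_one := (powerClass_eq_zero_iff (neg_ne_zero.2 one_ne_zero)).2 ⟨-1, hodd.neg_one_pow⟩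
  map_one_sub := by
    intro x hx hcx
    have hx' : ∀ c : F, c ^ p ≠ x := fun c hc => hcx ((powerClass_eq_zero_iff hx).2 ⟨c, hc⟩)
    obtain ⟨k, c, hk⟩ := h x hx'
    refine ⟨k, ?_⟩
    have h10 : 1 - x ≠ 0 := fun h0 => hx' 1 (by rw [one_pow]; exact sub_eq_zero.1 h0)
    have hcp : c ^ p ≠ 0 := by
      intro h0; rw [h0, mul_zero] at hk; exact h10 hk
    rw [hk, powerClass_mul (pow_ne_zero _ hx) hcp, powerClass_pow hx,
      (powerClass_eq_zero_iff hcp).2 ⟨c, rfl⟩, add_zero]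

theorem IsSteinbergRigid.exists_isRigidValuation [Fact p.Prime] (hodd : Odd p)
    (h : IsSteinbergRigid p F) : ∃ O : ValuationSubring F, IsRigidValuation p O := by
  have h2 : (2 : ZMod p) ≠ 0 := by
    have h2' : ((2 : ℕ) : ZMod p) ≠ 0 := by
      rw [Ne, ZMod.natCast_eq_zero_iff]
      intro hd
      have := (Nat.prime_dvd_prime_iff_eq Fact.out Nat.prime_two).1 hd
      subst this
      exact absurd hodd (by decide)
    exact_mod_cast h2'
  obtain ⟨O, v, h1, h3⟩ := (h.isSteinbergMap hodd).exists_valuationSubring h2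
  have hne : ∀ x : F, O.valuation x = 1 → x ≠ 0 := by
    rintro x hx rfl; simp at hx
  refine ⟨O, fun x hx => ?_, fun x y hx hy hxp => ?_⟩
  · have h0 : 1 + x ≠ 0 := by
      intro h0
      have : x = -1 := by linear_combination h0
      rw [this, Valuation.map_neg, map_one] at hx
      exact lt_irrefl _ hx
    exact (powerClass_eq_zero_iff h0).1 (h1 x hx)
  · obtain ⟨r, hr⟩ := Submodule.mem_span_singleton.1 (h3 x hx)
    obtain ⟨s, hs⟩ := Submodule.mem_span_singleton.1 (h3 y hy)
    have hr0 : r ≠ 0 := by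
      rintro rfl
      rw [zero_smul] at hr
      obtain ⟨c, hc⟩ := (powerClass_eq_zero_iff (hne x hx)).1 hr.symm
      exact hxp c hc
    refine exists_eq_pow_mul_pow (hne x hx) (hne y hy) (k := s * r⁻¹) ?_
    rw [← hr, ← hs, smul_smul, inv_mul_cancel_right₀ hr0]

end PowerClasses

/-! ### Extending valuation rings -/

section Extension

variable {F E : Type*} [Field F] [Field E] [Algebra F E]

/-- Every valuation ring extends to every extension field. -/
lemma exists_valuationSubring_extension (O : ValuationSubring F) :
    ∃ A : ValuationSubring E,
      (∀ x : F, A.valuation (algebraMap F E x) < 1 ↔ O.valuation x < 1) ∧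
      ∀ x : F, A.valuation (algebraMap F E x) = 1 ↔ O.valuation x = 1 := by
  obtain ⟨A, hA, hloc⟩ :=
    IsLocalRing.exists_factor_valuationRing ((algebraMap F E).comp O.subtype)
  have hle : ∀ x : F, O.valuation x ≤ 1 → A.valuation (algebraMap F E x) ≤ 1 := fun x hx =>
    (A.valuation_le_one_iff _).2 (hA ⟨x, (O.valuation_le_one_iff x).1 hx⟩)
  have heq : ∀ x : F, O.valuation x = 1 → A.valuation (algebraMap F E x) = 1 := by
    intro x hx
    refine le_antisymm (hle x hx.le) ?_
    have := hle x⁻¹ (by rw [map_inv₀, hx, inv_one])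
    rw [map_inv₀, map_inv₀] at this
    have hx0 : x ≠ 0 := by rintro rfl; simp at hx
    exact (inv_le_one₀ (by simpa [zero_lt_iff] using hx0)).1 this
  have hlt : ∀ x : F, O.valuation x < 1 → A.valuation (algebraMap F E x) < 1 := by
    intro x hx
    refine (hle x hx.le).lt_of_ne fun h1 => ?_
    have hxO := (O.valuation_le_one_iff x).1 hx.le
    have hu : IsUnit ((((algebraMap F E).comp O.subtype).codRestrict A.toSubring hA) ⟨x, hxO⟩) :=
      (A.valuation_eq_one_iff ⟨_, hA ⟨x, hxO⟩⟩).2 h1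
    have := (O.valuation_eq_one_iff ⟨x, hxO⟩).1 (isUnit_of_map_unit _ _ hu)
    exact hx.ne this
  have hgt : ∀ x : F, 1 < O.valuation x → 1 < A.valuation (algebraMap F E x) := by
    intro x hx
    have := hlt x⁻¹ (by rw [map_inv₀]; exact inv_lt_one_of_one_lt₀ hx)
    rw [map_inv₀, map_inv₀] at this
    have hx0 : x ≠ 0 := by rintro rfl; simp at hx
    exact (inv_lt_one₀ (by simpa [zero_lt_iff] using hx0)).1 this
  refine ⟨A, fun x => ⟨fun h => ?_, hlt x⟩, fun x => ⟨fun h => ?_, heq x⟩⟩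
  · rcases lt_trichotomy (O.valuation x) 1 with h1 | h1 | h1
    · exact h1
    · exact absurd (heq x h1) h.ne
    · exact absurd (hgt x h1) h.not_gt
  · rcases lt_trichotomy (O.valuation x) 1 with h1 | h1 | h1
    · exact absurd h (hlt x h1).ne
    · exact h1
    · exact absurd h (hgt x h1).ne'

end Extension

/-! ### Kummer extensions of degree p and Hilbert's Theorem 90 -/

section Kummer

/-- `α` is a `p`-th root of `a`, generating a cyclic extension of degree `p` whose Galois group
is generated by `σ`, and `σ α = ζ α`. -/
structure IsKummerGenerator (p : ℕ) {F E : Type*} [Field F] [Field E] [Algebra F E]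
    (σ : Gal(E/F)) (α : E) (ζ a : F) : Prop where
  prim : IsPrimitiveRoot ζ p
  pow_eq : α ^ p = algebraMap F E a
  not_pow : ∀ c : F, c ^ p ≠ a
  apply_eq : σ α = algebraMap F E ζ * α
  norm_eq : ∀ x : E, algebraMap F E (Algebra.norm F x) = ∏ i ∈ Finset.range p, (σ ^ i) x
  exists_sum : ∀ y : E, ∃ c : ℕ → F, y = ∑ i ∈ Finset.range p, algebraMap F E (c i) * α ^ i
  mem_range_of_fixed : ∀ y : E, σ y = y → ∃ c : F, algebraMap F E c = y

variable {p : ℕ} {F E : Type*} [Field F] [Field E] [Algebra F E]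

lemma pow_apply_of_apply_eq {σ : Gal(E/F)} {α : E} {ζ : F} (h : σ α = algebraMap F E ζ * α)
    (i : ℕ) : (σ ^ i) α = algebraMap F E (ζ ^ i) * α := by
  induction i with
  | zero => simp
  | succ i ih =>
    rw [pow_succ', AlgEquiv.mul_apply, ih, map_mul, AlgEquiv.commutes, h, pow_succ, map_mul,
      mul_assoc]

section Generator

variable [Fact p.Prime] {α : E} {ζ a : F} (hζ : IsPrimitiveRoot ζ p)
  (hα : α ^ p = algebraMap F E a) (ha : ∀ c : F, c ^ p ≠ a)
  (htop : IntermediateField.adjoin F {α} = ⊤)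

include hα ha in
lemma minpoly_eq_X_pow_sub_C : minpoly F α = X ^ p - C a :=
  have hp : p.Prime := Fact.out
  (minpoly.eq_of_irreducible_of_monic (X_pow_sub_C_irreducible_of_prime hp ha)
    (by simp [hα]) (monic_X_pow_sub_C a hp.ne_zero)).symm

include hα in
lemma isIntegral_of_pow_eq : IsIntegral F α :=
  .of_pow (Fact.out : p.Prime).pos (hα ▸ isIntegral_algebraMap)

include hα ha htop in
lemma finrank_eq_of_pow_eq : Module.finrank F E = p := by
  rw [← IntermediateField.finrank_top', ← htop,
    IntermediateField.adjoin.finrank (isIntegral_of_pow_eq hα), minpoly_eq_X_pow_sub_C hα ha,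
    natDegree_X_pow_sub_C]

include hζ hα ha htop in
lemma isSplittingField_of_pow_eq : IsSplittingField F E (X ^ p - C a) := by
  have hp : p.Prime := Fact.out
  have hfr := finrank_eq_of_pow_eq hα ha htop
  have : FiniteDimensional F E := Module.finite_of_finrank_pos (by rw [hfr]; exact hp.pos)
  have := isSplittingField_X_pow_sub_C_of_root_adjoin_eq_top (K := F) (L := E) (a := a) (α := α)
    (by rw [hfr]; exact ⟨ζ, (mem_primitiveRoots hp.pos).2 hζ⟩) (by rwa [hfr]) htop
  rwa [hfr] at this

include hζ hα ha htop in
lemma isGalois_of_pow_eq : IsGalois F E :=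
  have hp : p.Prime := Fact.out
  have := isSplittingField_of_pow_eq hζ hα ha htop
  isGalois_of_isSplittingField_X_pow_sub_C ⟨ζ, (mem_primitiveRoots hp.pos).2 hζ⟩
    (X_pow_sub_C_irreducible_of_prime hp ha) E

include hζ hα ha htop in
theorem exists_isKummerGenerator : ∃ σ : Gal(E/F), IsKummerGenerator p σ α ζ a := by
  have hp : p.Prime := Fact.out
  have hirr : Irreducible (X ^ p - C a) := X_pow_sub_C_irreducible_of_prime hp ha
  have hmin := minpoly_eq_X_pow_sub_C hα ha
  have hint := isIntegral_of_pow_eq hα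
  have hfr := finrank_eq_of_pow_eq hα ha htop
  have : FiniteDimensional F E := Module.finite_of_finrank_pos (by rw [hfr]; exact hp.pos)
  have hK : (primitiveRoots p F).Nonempty := ⟨ζ, (mem_primitiveRoots hp.pos).2 hζ⟩
  have hsplit := isSplittingField_of_pow_eq hζ hα ha htop
  have hgal := isGalois_of_pow_eq hζ hα ha htop
  obtain ⟨σ, hσ⟩ : ∃ σ : Gal(E/F), σ α = algebraMap F E ζ * α := by
    refine ⟨(autEquivRootsOfUnity hK hirr E).symm (hζ.toRootsOfUnity), ?_⟩
    rw [← autEquivRootsOfUnity_smul hK hirr E hα, MulEquiv.apply_symm_apply]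
    rw [← Algebra.smul_def]
    rfl
  have hα0 : α ≠ 0 := by
    rintro rfl
    rw [zero_pow hp.ne_zero, eq_comm, map_eq_zero] at hα
    exact ha 0 (by rw [hα, zero_pow hp.ne_zero])
  have hinj : Function.Injective (fun i : Fin p => σ ^ (i : ℕ)) := by
    intro i j hij
    have h1 := congrArg (fun τ : Gal(E/F) => τ α) hij
    simp only [pow_apply_of_apply_eq hσ] at h1
    have h2 := (algebraMap F E).injective (mul_right_cancel₀ hα0 h1)
    exact Fin.ext (hζ.pow_inj i.2 j.2 h2)
  have hbij : Function.Bijective (fun i : Fin p => σ ^ (i : ℕ)) := by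
    refine (Fintype.bijective_iff_injective_and_card _).2 ⟨hinj, ?_⟩
    rw [Fintype.card_fin, ← Nat.card_eq_fintype_card, IsGalois.card_aut_eq_finrank, hfr]
  refine ⟨σ, hζ, hα, ha, hσ, fun x => ?_, fun y => ?_, fun y hy => ?_⟩
  · rw [Algebra.norm_eq_prod_automorphisms, ← hbij.prod_comp, Finset.prod_range]
  · have htop' : Algebra.adjoin F {α} = ⊤ :=
      Algebra.adjoin_root_eq_top_of_isSplittingField hK hirr hα
    obtain ⟨f, hf, hy⟩ := (PowerBasis.ofAdjoinEqTop hint htop').exists_eq_aeval y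
    rw [PowerBasis.ofAdjoinEqTop_gen] at hy
    rw [PowerBasis.ofAdjoinEqTop_dim, hmin, natDegree_X_pow_sub_C] at hf
    refine ⟨f.coeff, ?_⟩
    rw [hy, aeval_eq_sum_range' hf]
    simp only [Algebra.smul_def]
  · refine (IsGalois.mem_range_algebraMap_iff_fixed y).2 fun f => ?_
    obtain ⟨i, rfl⟩ := hbij.2 f
    change (σ ^ (i : ℕ)) y = y
    generalize (i : ℕ) = n
    induction n with
    | zero => rfl
    | succ n ih => rw [pow_succ, AlgEquiv.mul_apply, hy, ih]

end Generator

namespace IsKummerGenerator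

variable {σ : Gal(E/F)} {α : E} {ζ a : F}

lemma ne_zero (h : IsKummerGenerator p σ α ζ a) (hp : p ≠ 0) : α ≠ 0 := by
  rintro rfl
  have := h.pow_eq
  rw [zero_pow hp, eq_comm, map_eq_zero] at this
  exact h.not_pow 0 (by rw [this, zero_pow hp])

lemma pow_apply (h : IsKummerGenerator p σ α ζ a) (y : E) : (σ ^ p) y = y := by
  obtain ⟨c, rfl⟩ := h.exists_sum y
  simp only [map_sum, map_mul, map_pow, AlgEquiv.commutes, pow_apply_of_apply_eq h.apply_eq,
    h.prim.pow_eq_one, map_one, one_mul]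

/-- Changing a by a p-th power is what allows α to be made a unit in the unramified case. -/
lemma scale (h : IsKummerGenerator p σ α ζ a) {d : F} (hd : d ≠ 0) :
    IsKummerGenerator p σ (algebraMap F E d * α) ζ (d ^ p * a) where
  prim := h.prim
  pow_eq := by rw [mul_pow, h.pow_eq, map_mul, map_pow]
  not_pow := by
    intro c hc
    refine h.not_pow (c / d) ?_
    rw [div_pow, hc]
    field_simp
  apply_eq := by rw [map_mul, AlgEquiv.commutes, h.apply_eq]; ring
  norm_eq := h.norm_eq
  exists_sum := by
    intro y
    obtain ⟨c, hc⟩ := h.exists_sum y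
    refine ⟨fun i => c i / d ^ i, ?_⟩
    rw [hc]
    refine Finset.sum_congr rfl fun i _ => ?_
    have : algebraMap F E d ≠ 0 := by simpa using hd
    rw [map_div₀, map_pow, mul_pow]
    field_simp
  mem_range_of_fixed := h.mem_range_of_fixed

/-- An element of `F` which becomes a `p`-th power in `E` is a power of `a` modulo `p`-th powers. -/
lemma exists_of_pow_eq [NeZero p] (h : IsKummerGenerator p σ α ζ a) {e : E} {b : F}
    (he : e ^ p = algebraMap F E b) : ∃ k < p, ∃ c : F, b = a ^ k * c ^ p := by
  have hp : p ≠ 0 := NeZero.ne p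
  rcases eq_or_ne e 0 with rfl | he0
  · rw [zero_pow hp, eq_comm, map_eq_zero] at he
    exact ⟨0, Nat.pos_of_ne_zero hp, 0, by rw [he, zero_pow hp, mul_zero]⟩
  have hα0 := h.ne_zero hp
  have h1 : (σ e / e) ^ p = 1 := by
    rw [div_pow, ← map_pow, he, AlgEquiv.commutes, div_self]
    rw [← he]; exact pow_ne_zero _ he0
  obtain ⟨k, hk, hk'⟩ :=
    (h.prim.map_of_injective (algebraMap F E).injective).eq_pow_of_pow_eq_one h1
  rw [eq_div_iff he0] at hk'
  have hz : algebraMap F E ζ ≠ 0 := by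
    simpa using h.prim.ne_zero hp
  obtain ⟨c, hc⟩ := h.mem_range_of_fixed (e / α ^ k) (by
    rw [map_div₀, map_pow, h.apply_eq, mul_pow, ← hk']
    field_simp)
  refine ⟨k, hk, c, (algebraMap F E).injective ?_⟩
  rw [map_mul, map_pow, map_pow, hc, div_pow, ← he, ← h.pow_eq]
  have : α ^ p ≠ 0 := pow_ne_zero _ hα0
  rw [← pow_mul, ← pow_mul, mul_comm k p]
  field_simp

lemma norm_algebraMap (h : IsKummerGenerator p σ α ζ a) (c : F) :
    Algebra.norm F (algebraMap F E c) = c ^ p := by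
  apply (algebraMap F E).injective
  rw [h.norm_eq]
  simp

lemma norm_generator (h : IsKummerGenerator p σ α ζ a) (hodd : Odd p) :
    Algebra.norm F α = a := by
  apply (algebraMap F E).injective
  rw [h.norm_eq]
  simp only [pow_apply_of_apply_eq h.apply_eq]
  rw [Finset.prod_mul_distrib, Finset.prod_const, Finset.card_range, h.pow_eq, ← map_prod,
    Finset.prod_pow_eq_pow_sum]
  obtain ⟨m, hm⟩ := hodd
  have h1 := Finset.sum_range_id_mul_two p
  have h2 : ∑ i ∈ Finset.range p, i = p * m := by
    have : p - 1 = m * 2 := by omega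
    rw [this, ← mul_assoc] at h1
    exact Nat.eq_of_mul_eq_mul_right two_pos h1
  rw [h2, pow_mul, h.prim.pow_eq_one, one_pow, map_one, one_mul]

lemma norm_one_sub (h : IsKummerGenerator p σ α ζ a) (hp : 0 < p) :
    Algebra.norm F (1 - α) = 1 - a := by
  apply (algebraMap F E).injective
  rw [h.norm_eq]
  have h1 := (h.prim.map_of_injective (algebraMap F E).injective).pow_sub_pow_eq_prod_sub_mul
    1 α hp
  have h3 := h.prim.map_of_injective (algebraMap F E).injective
  have : NeZero p := ⟨hp.ne'⟩
  rw [map_sub, map_one, ← h.pow_eq, ← one_pow p, h1]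
  refine Finset.prod_bij (fun i _ => (algebraMap F E ζ) ^ i) ?_ ?_ ?_ ?_
  · intro i _
    rw [mem_nthRootsFinset hp, ← pow_mul, mul_comm, pow_mul, h3.pow_eq_one, one_pow]
  · intro i hi j hj hij
    exact h3.pow_inj (Finset.mem_range.1 hi) (Finset.mem_range.1 hj) hij
  · intro η hη
    obtain ⟨i, hi, hi'⟩ := h3.eq_pow_of_pow_eq_one ((mem_nthRootsFinset hp _).1 hη)
    exact ⟨i, Finset.mem_range.2 hi, hi'⟩
  · intro i _
    rw [map_sub, one_pow, map_one, pow_apply_of_apply_eq h.apply_eq, map_pow]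

/-- Hilbert's Theorem 90. -/
lemma exists_div_of_norm_eq_one [NeZero p] (h : IsKummerGenerator p σ α ζ a) {x : E}
    (hx : Algebra.norm F x = 1) : ∃ y : E, y ≠ 0 ∧ x = σ y / y := by
  have hp : p ≠ 0 := NeZero.ne p
  have hα0 := h.ne_zero hp
  have hnx : ∏ i ∈ Finset.range p, (σ ^ i) x = 1 := by rw [← h.norm_eq, hx, map_one]
  have hx0 : x ≠ 0 := by
    rintro rfl
    simp [hp] at hnx
  -- These partial norms are the coefficients of a resolvent θ. It is nonzero for some z by
  -- independence of characters, and b p = b 0 = 1 closes the cycle, giving x * σ θ = θ.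
  let b : ℕ → E := fun i => ∏ j ∈ Finset.range i, (σ ^ j) x
  have hb : ∀ i, x * σ (b i) = b (i + 1) := by
    intro i
    simp only [b]
    rw [Finset.prod_range_succ', map_prod, mul_comm]
    simp only [pow_succ', AlgEquiv.mul_apply, pow_zero, AlgEquiv.one_apply]
  obtain ⟨z, hz⟩ : ∃ z : E, ∑ i ∈ Finset.range p, b i * (σ ^ i) z ≠ 0 := by
    by_contra! hcon
    let f : Fin p → (E →* E) := fun i => ((σ ^ (i : ℕ) : Gal(E/F)) : E →* E)
    have hf : Function.Injective f := by
      intro i j hij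
      have h1 : (σ ^ (i : ℕ)) α = (σ ^ (j : ℕ)) α := DFunLike.congr_fun hij α
      rw [pow_apply_of_apply_eq h.apply_eq, pow_apply_of_apply_eq h.apply_eq] at h1
      exact Fin.ext (h.prim.pow_inj i.2 j.2
        ((algebraMap F E).injective (mul_right_cancel₀ hα0 h1)))
    have hli := (linearIndependent_monoidHom E E).comp f hf
    have := Fintype.linearIndependent_iff.1 hli (fun i => b i) (by
      ext z
      have := hcon z
      rw [Finset.sum_range] at this
      simpa [f] using this) ⟨0, Nat.pos_of_ne_zero hp⟩
    simp [b] at this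
  set θ := ∑ i ∈ Finset.range p, b i * (σ ^ i) z with hθ
  have key : x * σ θ = θ := by
    rw [hθ, map_sum, Finset.mul_sum]
    have : ∀ i ∈ Finset.range p, x * σ (b i * (σ ^ i) z) = b (i + 1) * (σ ^ (i + 1)) z := by
      intro i _
      rw [map_mul, ← mul_assoc, hb, pow_succ', AlgEquiv.mul_apply]
    rw [Finset.sum_congr rfl this]
    have h2 := Finset.sum_range_succ (fun i => b i * (σ ^ i) z) p
    have h3 := Finset.sum_range_succ' (fun i => b i * (σ ^ i) z) p
    have hbp : b p = 1 := hnx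
    have hb0 : b 0 = 1 := rfl
    rw [h2, hbp, hb0, h.pow_apply, pow_zero, AlgEquiv.one_apply] at h3
    exact (add_right_cancel h3).symm
  have hσθ : σ θ ≠ 0 := by simpa using hz
  refine ⟨θ⁻¹, inv_ne_zero hz, ?_⟩
  rw [map_inv₀]
  field_simp
  linear_combination key

end IsKummerGenerator

end Kummer

/-! ### Power classes of a Kummer extension -/

section Kummer

variable {p : ℕ} {F E : Type*} [Field F] [Field E] [Algebra F E]

/-- The endomorphism `σ - 1` of the multiplicative group of `E`. -/
def augmentation (σ : Gal(E/F)) : Module.End ℤ (Additive Eˣ) :=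
  (MonoidHom.toAdditive (Units.map (σ : E →* E))).toIntLinearMap - 1

lemma augmentation_apply (σ : Gal(E/F)) (u : Eˣ) :
    (((augmentation σ (Additive.ofMul u)).toMul : Eˣ) : E) = σ u / u := by
  simp [augmentation, div_eq_mul_inv]

/-- In the binomial expansion of (S - 1)^p the middle terms are divisible by p, and the outer ones
cancel because S^p = 1 and (-1)^p = -1. -/
lemma exists_augmentation_pow_eq (hp : p.Prime) (hodd : Odd p) {σ : Gal(E/F)}
    (hσ : ∀ y : E, (σ ^ p) y = y) : ∃ r : Module.End ℤ (Additive Eˣ),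
      augmentation σ ^ p = (p : Module.End ℤ (Additive Eˣ)) * r := by
  set S : Module.End ℤ (Additive Eˣ) := (MonoidHom.toAdditive (Units.map (σ : E →* E))).toIntLinearMap with hS
  have hSn : ∀ (n : ℕ) (u : Eˣ),
      ((((S ^ n) (Additive.ofMul u)).toMul : Eˣ) : E) = (σ ^ n) u := by
    intro n
    induction n with
    | zero => intro u; simp
    | succ n ih =>
      intro u
      rw [pow_succ, Module.End.mul_apply, pow_succ, AlgEquiv.mul_apply]
      exact ih (Units.map (σ : E →* E) u)
  have hSp : S ^ p = 1 := by
    ext u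
    exact (hSn p u.toMul).trans (hσ _)
  have hc : Commute S (-1) := (Commute.one_right S).neg_right
  obtain ⟨r, hr⟩ := hc.exists_add_pow_prime_eq hp
  refine ⟨S * (-1) * r, ?_⟩
  have h1 : augmentation σ = S + -1 := sub_eq_add_neg _ _
  rw [h1, hr, hSp, hodd.neg_one_pow, add_neg_cancel, zero_add, mul_assoc, mul_assoc, mul_assoc]

namespace IsKummerGenerator

variable {σ : Gal(E/F)} {α : E} {ζ a : F}

/-- If all norms are powers of `a` up to `p`-th powers, then `E` is generated by `α` and `F`
up to `p`-th powers. -/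
lemma exists_eq_mul_pow [NeZero p] (h : IsKummerGenerator p σ α ζ a) (hp : p.Prime) (hodd : Odd p)
    (hN : ∀ y : E, y ≠ 0 → ∃ (k : ℕ) (c : F), Algebra.norm F y = a ^ k * c ^ p) {x : E}
    (hx : x ≠ 0) : ∃ (k : ℕ) (c : F) (e : E), x = α ^ k * algebraMap F E c * e ^ p := by
  have hα0 := h.ne_zero hp.ne_zero
  have hz : algebraMap F E ζ ≠ 0 := by simpa using h.prim.ne_zero hp.ne_zero
  have red : ∀ y : E, y ≠ 0 → ∃ (k : ℕ) (c : F) (y' : E), y' ≠ 0 ∧ c ≠ 0 ∧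
      Algebra.norm F y' = 1 ∧ y = α ^ k * algebraMap F E c * y' := by
    intro y hy
    obtain ⟨k, c, hk⟩ := hN y hy
    have hny : Algebra.norm F y ≠ 0 := by
      intro h0
      have := h.norm_eq y
      rw [h0, map_zero, eq_comm, Finset.prod_eq_zero_iff] at this
      obtain ⟨i, _, hi⟩ := this
      exact hy ((map_eq_zero_iff _ (σ ^ i).injective).1 hi)
    have hc0 : c ≠ 0 := by
      rintro rfl
      rw [zero_pow hp.ne_zero, mul_zero] at hk
      exact hny hk
    have hc0' : algebraMap F E c ≠ 0 := by simpa using hc0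
    have hd : α ^ k * algebraMap F E c ≠ 0 := mul_ne_zero (pow_ne_zero _ hα0) hc0'
    refine ⟨k, c, y / (α ^ k * algebraMap F E c), div_ne_zero hy hd, hc0, ?_, by field_simp⟩
    have h1 : Algebra.norm F (y / (α ^ k * algebraMap F E c)) *
        Algebra.norm F (α ^ k * algebraMap F E c) = Algebra.norm F y := by
      rw [← map_mul, div_mul_cancel₀ _ hd]
    rw [map_mul, map_pow, h.norm_algebraMap, h.norm_generator hodd, ← hk] at h1
    exact mul_eq_right₀ hny |>.1 h1
  set D := augmentation σ with hD
  have hDz : ∀ (m : ℕ) (v : Eˣ), (v : E) = algebraMap F E ζ ^ m → D (Additive.ofMul v) = 0 := by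
    intro m v hv
    apply Additive.toMul.injective
    ext
    rw [augmentation_apply, hv, ← map_pow, AlgEquiv.commutes, div_self]
    · rfl
    · simpa using fun h0 => absurd h0 (h.prim.ne_zero hp.ne_zero)
  -- Hilbert 90 gives x = σ y / y. By `red`, y = α ^ k * c * y' with y' of norm 1, hence x = ζ ^ k *
  -- (σ y' / y'). The argument repeats with y', and `D` kills the root of unity that it produces.
  have key : ∀ (n : ℕ) (x : Eˣ), Algebra.norm F (x : E) = 1 → ∃ (m : ℕ) (u : Eˣ) (v : Eˣ),
      (v : E) = algebraMap F E ζ ^ m ∧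
      Additive.ofMul x = Additive.ofMul v + (D ^ n) (Additive.ofMul u) := by
    intro n
    induction n with
    | zero =>
      intro x _
      exact ⟨0, x, 1, by simp, by simp⟩
    | succ n ih =>
      intro x hx1
      obtain ⟨y, hy, hxy⟩ := h.exists_div_of_norm_eq_one hx1
      obtain ⟨k, c, y', hy', hc, hny', hyy⟩ := red y hy
      obtain ⟨m, u, v, hv, hu⟩ := ih (Units.mk0 y' hy') hny'
      refine ⟨k, u, Units.mk0 (algebraMap F E ζ ^ k) (pow_ne_zero _ hz), rfl, ?_⟩
      have h1 : (D ^ (n + 1)) (Additive.ofMul u) = D (Additive.ofMul (Units.mk0 y' hy')) := by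
        rw [hu, map_add, hDz m v hv, zero_add, pow_succ']
        rfl
      rw [h1]
      apply Additive.toMul.injective
      ext
      rw [toMul_add, Units.val_mul, augmentation_apply]
      change (x : E) = algebraMap F E ζ ^ k * (σ y' / y')
      rw [hxy, hyy]
      have hc' : algebraMap F E c ≠ 0 := by simpa using hc
      rw [map_mul, map_mul, map_pow, h.apply_eq, AlgEquiv.commutes, mul_pow]
      field_simp
  obtain ⟨k, c, x', hx', hc, hnx', hxx⟩ := red x hx
  obtain ⟨m, u, v, hv, hu⟩ := key p (Units.mk0 x' hx') hnx'
  -- After p rounds the remaining factor is in the image of `D ^ p`, so it is a p-th power.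
  obtain ⟨r, hr⟩ := exists_augmentation_pow_eq hp hodd h.pow_apply
  rw [← hD] at hr
  refine ⟨k, c * ζ ^ m, (((r (Additive.ofMul u)).toMul : Eˣ) : E), ?_⟩
  rw [hr] at hu
  have h2 : ((p : Module.End ℤ (Additive Eˣ)) * r) (Additive.ofMul u)
      = p • r (Additive.ofMul u) := by
    rw [Module.End.mul_apply, Module.End.natCast_apply]
  have h3 : x' = v * (((r (Additive.ofMul u)).toMul : Eˣ) : E) ^ p := by
    rw [h2] at hu
    have := congrArg (fun t : Additive Eˣ => ((t.toMul : Eˣ) : E)) hu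
    simpa using this
  rw [hxx, h3, hv, map_mul, map_pow]
  ring

end IsKummerGenerator

end Kummer

/-! ### Valuations on a Kummer extension and the ramified case -/

section Gauss

variable {p : ℕ} {F E : Type*} [Field F] [Field E] [Algebra F E]

lemma exists_mul_eq_one_add_mul (hp : p.Prime) {k : ℕ} (hk : ¬ p ∣ k) :
    ∃ m n : ℕ, k * m = 1 + p * n := by
  have hc : Nat.Coprime k p := ((Nat.Prime.coprime_iff_not_dvd hp).2 hk).symm
  obtain ⟨m, hm⟩ := Nat.exists_mul_mod_eq_one_of_coprime hc hp.one_lt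
  refine ⟨m, k * m / p, ?_⟩
  have := Nat.mod_add_div (k * m) p
  omega

/-- The valuation of a polynomial expression in `α` of degree less than `p` is the maximum of the
valuations of its terms. -/
def IsGaussGenerator {Γ : Type*} [LinearOrderedCommGroupWithZero Γ] (p : ℕ) (F : Type*) {E : Type*}
    [Field F] [Field E] [Algebra F E] (w : Valuation E Γ) (α : E) : Prop :=
  ∀ (c : ℕ → F), ∀ i < p,
    w (algebraMap F E (c i) * α ^ i) ≤ w (∑ j ∈ Finset.range p, algebraMap F E (c j) * α ^ j)

namespace IsKummerGenerator

variable {σ : Gal(E/F)} {α : E} {ζ a : F} {Γ : Type*} [LinearOrderedCommGroupWithZero Γ]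
  {w : Valuation E Γ}

lemma valuation_root_of_unity [NeZero p] (h : IsKummerGenerator p σ α ζ a) :
    w (algebraMap F E ζ) = 1 := by
  have h1 : w (algebraMap F E ζ) ^ p = 1 := by
    rw [← map_pow, ← map_pow, h.prim.pow_eq_one, map_one, map_one]
  exact (pow_eq_one_iff_of_nonneg zero_le (NeZero.ne p)).1 h1

/-- The automorphism multiplies each term of the expansion in powers of α by a root of unity, and
the largest term controls the value of the sum. This is how norms of units and of principal units
are kept under control. -/
lemma valuation_apply_le [NeZero p] (h : IsKummerGenerator p σ α ζ a)
    (hg : IsGaussGenerator p F w α) (y : E) : w (σ y) ≤ w y := by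
  obtain ⟨c, rfl⟩ := h.exists_sum y
  rw [map_sum]
  refine Valuation.map_sum_le _ fun i hi => ?_
  rw [map_mul, map_pow, AlgEquiv.commutes, h.apply_eq, mul_pow, mul_left_comm, map_mul, map_pow,
    h.valuation_root_of_unity, one_pow, one_mul]
  exact hg c i (Finset.mem_range.1 hi)

lemma valuation_pow_apply_le [NeZero p] (h : IsKummerGenerator p σ α ζ a)
    (hg : IsGaussGenerator p F w α) (i : ℕ) (y : E) : w ((σ ^ i) y) ≤ w y := by
  induction i with
  | zero => rfl
  | succ i ih =>
    rw [pow_succ', AlgEquiv.mul_apply]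
    exact (h.valuation_apply_le hg _).trans ih

lemma valuation_norm_one_add [NeZero p] (h : IsKummerGenerator p σ α ζ a)
    (hg : IsGaussGenerator p F w α) {ε : E} (hε : w ε < 1) :
    w (algebraMap F E (Algebra.norm F (1 + ε) - 1)) < 1 := by
  rw [map_sub, h.norm_eq, map_one]
  suffices H : ∀ n, w (∏ i ∈ Finset.range n, (σ ^ i) (1 + ε) - 1) < 1 from H p
  intro n
  induction n with
  | zero => simp
  | succ n ih =>
    rw [Finset.prod_range_succ, map_add, map_one]
    set P := ∏ i ∈ Finset.range n, (σ ^ i) (1 + ε)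
    have h1 : w ((σ ^ n) ε) < 1 := (h.valuation_pow_apply_le hg n ε).trans_lt hε
    have h2 : w P ≤ 1 := by
      rw [show P = (P - 1) + 1 by ring]
      exact (Valuation.map_add _ _ _).trans (max_le ih.le (by rw [map_one]))
    rw [show P * (1 + (σ ^ n) ε) - 1 = (P - 1) + P * (σ ^ n) ε by ring]
    refine Valuation.map_add_lt _ ih ?_
    rw [map_mul]
    exact mul_lt_one_of_nonneg_of_lt_one_right h2 zero_le h1

lemma valuation_norm_eq_one [NeZero p] (h : IsKummerGenerator p σ α ζ a)
    (hg : IsGaussGenerator p F w α) {u : E} (hu : w u = 1) :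
    w (algebraMap F E (Algebra.norm F u)) = 1 := by
  have hle : ∀ u : E, w u = 1 → w (algebraMap F E (Algebra.norm F u)) ≤ 1 := by
    intro u hu
    rw [h.norm_eq, map_prod]
    exact Finset.prod_le_one' fun i _ => (h.valuation_pow_apply_le hg i u).trans hu.le
  refine le_antisymm (hle u hu) ?_
  have h1 := hle u⁻¹ (by rw [map_inv₀, hu, inv_one])
  have hu0 : u ≠ 0 := by rintro rfl; simp at hu
  have h2 : w (algebraMap F E (Algebra.norm F u)) * w (algebraMap F E (Algebra.norm F u⁻¹)) = 1 := by
    rw [← map_mul, ← map_mul, ← map_mul, mul_inv_cancel₀ hu0, map_one, map_one, map_one]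
  calc (1 : Γ) = w (algebraMap F E (Algebra.norm F u)) * w (algebraMap F E (Algebra.norm F u⁻¹)) :=
        h2.symm
    _ ≤ w (algebraMap F E (Algebra.norm F u)) * 1 := by gcongr
    _ = _ := mul_one _

section Ramified

variable (hA : ∀ c : F, c ≠ 0 → w (algebraMap F E (c ^ p * a)) ≠ 1)

include hA in
-- With nm = 1 + pq, the power (e α^n)^(mp) equals (e^m a^q)^p a, which is not a unit by `hA`.
lemma valuation_mul_pow_ne_one (h : IsKummerGenerator p σ α ζ a) (hp : p.Prime) {e : F}
    (he : e ≠ 0) {n : ℕ} (hn : ¬ p ∣ n) : w (algebraMap F E e * α ^ n) ≠ 1 := by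
  intro h1
  obtain ⟨m, q, hmq⟩ := exists_mul_eq_one_add_mul hp hn
  have ha0 : a ≠ 0 := by
    rintro rfl; exact h.not_pow 0 (zero_pow hp.ne_zero)
  refine hA (e ^ m * a ^ q) (mul_ne_zero (pow_ne_zero _ he) (pow_ne_zero _ ha0)) ?_
  have h2 : algebraMap F E ((e ^ m * a ^ q) ^ p * a) = ((algebraMap F E e * α ^ n) ^ m) ^ p := by
    rw [mul_pow (algebraMap F E e), ← pow_mul α, hmq, pow_add, pow_one, pow_mul α, h.pow_eq]
    simp only [map_mul, map_pow, mul_pow, h.pow_eq]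
    ring
  rw [h2, map_pow, map_pow, h1, one_pow, one_pow]

include hA in
lemma valuation_term_ne (h : IsKummerGenerator p σ α ζ a) (hp : p.Prime) {c d : F}
    (hc : c ≠ 0) (hd : d ≠ 0) {i j : ℕ} (hi : i < p) (hj : j < p) (hij : i ≠ j) :
    w (algebraMap F E c * α ^ i) ≠ w (algebraMap F E d * α ^ j) := by
  wlog hlt : i < j generalizing i j c d
  · exact (this hd hc hj hi hij.symm (by omega)).symm
  intro heq
  have hα0 := h.ne_zero hp.ne_zero
  have hc' : algebraMap F E c ≠ 0 := by simpa using hc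
  refine h.valuation_mul_pow_ne_one hA hp (div_ne_zero hd hc) (n := j - i)
    (fun hdvd => by have := Nat.le_of_dvd (by omega) hdvd; omega) ?_
  have h1 : algebraMap F E (d / c) * α ^ (j - i) =
      (algebraMap F E d * α ^ j) / (algebraMap F E c * α ^ i) := by
    rw [map_div₀, pow_sub₀ _ hα0 hlt.le]
    field_simp
  rw [h1, map_div₀, heq, div_self]
  rw [← heq]
  exact (w.ne_zero_iff).2 (mul_ne_zero hc' (pow_ne_zero _ hα0))

include hA in
lemma exists_dominant_term (h : IsKummerGenerator p σ α ζ a) (hp : p.Prime) (c : ℕ → F)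
    (hc : ∃ j < p, c j ≠ 0) :
    ∃ i < p, c i ≠ 0 ∧
      (∀ j < p, w (algebraMap F E (c j) * α ^ j) ≤ w (algebraMap F E (c i) * α ^ i)) ∧
      w (∑ j ∈ Finset.range p, algebraMap F E (c j) * α ^ j - algebraMap F E (c i) * α ^ i) <
        w (algebraMap F E (c i) * α ^ i) := by
  obtain ⟨i, hi, hmax⟩ := (Finset.range p).exists_max_image
    (fun j => w (algebraMap F E (c j) * α ^ j)) ⟨0, Finset.mem_range.2 hp.pos⟩
  have hα0 := h.ne_zero hp.ne_zero
  have hci : c i ≠ 0 := by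
    intro h0
    obtain ⟨j, hj, hcj⟩ := hc
    have := hmax j (Finset.mem_range.2 hj)
    simp only [h0, map_zero, zero_mul] at this
    exact mul_ne_zero (by simpa using hcj) (pow_ne_zero j hα0)
      ((w.zero_iff).1 (le_antisymm this zero_le))
  have hne : w (algebraMap F E (c i) * α ^ i) ≠ 0 :=
    (w.ne_zero_iff).2 (mul_ne_zero (by simpa using hci) (pow_ne_zero _ hα0))
  refine ⟨i, Finset.mem_range.1 hi, hci, fun j hj => hmax j (Finset.mem_range.2 hj), ?_⟩
  rw [← Finset.add_sum_erase _ _ hi, add_sub_cancel_left]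
  refine Valuation.map_sum_lt _ hne fun j hj => ?_
  obtain ⟨hji, hj⟩ := Finset.mem_erase.1 hj
  by_cases hcj : c j = 0
  · rw [hcj, map_zero, zero_mul, map_zero]; exact zero_lt_iff.2 hne
  · exact (hmax j hj).lt_of_ne (h.valuation_term_ne hA hp hcj hci (Finset.mem_range.1 hj)
      (Finset.mem_range.1 hi) hji)

include hA in
lemma isGaussGenerator_of_ramified (h : IsKummerGenerator p σ α ζ a) (hp : p.Prime) :
    IsGaussGenerator p F w α := by
  intro c i hi
  by_cases hci : c i = 0
  · rw [hci, map_zero, zero_mul, map_zero]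
    exact zero_le
  · obtain ⟨j, hj, hcj, hmax, hlt⟩ := h.exists_dominant_term hA hp c ⟨i, hi, hci⟩
    refine (hmax i hi).trans ?_
    set y := ∑ j ∈ Finset.range p, algebraMap F E (c j) * α ^ j
    rw [show y = algebraMap F E (c j) * α ^ j + (y - algebraMap F E (c j) * α ^ j) by ring,
      Valuation.map_add_eq_of_lt_left _ hlt]

include hA in
lemma exists_eq_mul_one_add (h : IsKummerGenerator p σ α ζ a) (hp : p.Prime) {y : E}
    (hy : y ≠ 0) : ∃ (i : ℕ) (c : F) (ε : E), c ≠ 0 ∧ w ε < 1 ∧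
      y = algebraMap F E c * α ^ i * (1 + ε) := by
  obtain ⟨c, rfl⟩ := h.exists_sum y
  obtain ⟨i, hi, hci, -, hlt⟩ := h.exists_dominant_term hA hp c (by
    by_contra! hcon
    refine hy (Finset.sum_eq_zero fun j hj => ?_)
    rw [hcon j (Finset.mem_range.1 hj), map_zero, zero_mul])
  have hne : algebraMap F E (c i) * α ^ i ≠ 0 :=
    mul_ne_zero (by simpa using hci) (pow_ne_zero _ (h.ne_zero hp.ne_zero))
  refine ⟨i, c i, (∑ j ∈ Finset.range p, algebraMap F E (c j) * α ^ j -
    algebraMap F E (c i) * α ^ i) / (algebraMap F E (c i) * α ^ i), hci, ?_, ?_⟩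
  · rw [map_div₀]
    exact (div_lt_one₀ (zero_lt_iff.2 ((w.ne_zero_iff).2 hne))).2 hlt
  · rw [mul_add, mul_one, mul_div_cancel₀ _ hne]
    ring

end Ramified

end IsKummerGenerator

end Gauss

/-! ### Rigid valuations ascend to Kummer extensions -/

section Ascent

variable {p : ℕ} {F E : Type*} [Field F] [Field E] [Algebra F E]

lemma valuation_pow_sub_one_lt {R Γ : Type*} [CommRing R] [LinearOrderedCommGroupWithZero Γ]
    (w : Valuation R Γ) {e : R} (he : w (e - 1) < 1) (n : ℕ) : w (e ^ n - 1) < 1 := by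
  have he1 : w e ≤ 1 := by
    rw [show e = (e - 1) + 1 by ring]
    exact (Valuation.map_add _ _ _).trans (max_le he.le (by rw [map_one]))
  induction n with
  | zero => simp
  | succ n ih =>
    rw [show e ^ (n + 1) - 1 = e * (e ^ n - 1) + (e - 1) by ring]
    refine Valuation.map_add_lt _ ?_ he
    rw [map_mul]
    exact mul_lt_one_of_nonneg_of_lt_one_right he1 zero_le ih

namespace IsKummerGenerator

variable {σ : Gal(E/F)} {α : E} {ζ a : F} {A : ValuationSubring E}
  (hprin : ∀ x : F, A.valuation (algebraMap F E x) < 1 → ∃ c : F, c ^ p = 1 + x)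
  (hcyc : ∀ x y : F, A.valuation (algebraMap F E x) = 1 → A.valuation (algebraMap F E y) = 1 →
    (∀ c : F, c ^ p ≠ x) → ∃ (k : ℕ) (c : F), y = x ^ k * c ^ p)

include hprin in
lemma exists_norm_one_add_eq [NeZero p] (h : IsKummerGenerator p σ α ζ a)
    (hg : IsGaussGenerator p F A.valuation α) {ε : E} (hε : A.valuation ε < 1) :
    ∃ c : F, c ^ p = Algebra.norm F (1 + ε) := by
  obtain ⟨c, hc⟩ := hprin _ (h.valuation_norm_one_add hg hε)
  exact ⟨c, by rw [hc]; ring⟩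

section Ramified

variable (hA : ∀ c : F, c ≠ 0 → A.valuation (algebraMap F E (c ^ p * a)) ≠ 1)

include hprin hA in
lemma exists_norm_eq_of_ramified [NeZero p] (h : IsKummerGenerator p σ α ζ a) (hp : p.Prime)
    (hodd : Odd p) {y : E} (hy : y ≠ 0) :
    ∃ (k : ℕ) (c : F), Algebra.norm F y = a ^ k * c ^ p := by
  obtain ⟨i, c, ε, hc, hε, rfl⟩ := h.exists_eq_mul_one_add hA hp hy
  obtain ⟨d, hd⟩ := h.exists_norm_one_add_eq hprin (h.isGaussGenerator_of_ramified hA hp) hε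
  refine ⟨i, c * d, ?_⟩
  rw [map_mul, map_mul, map_pow, h.norm_algebraMap, h.norm_generator hodd, ← hd]
  ring

include hprin hA in
-- Write y = α^k f e^p and e = c α^i (1 + ε). Up to (1 + ε)^p, y is α^k times an element of F; since
-- y is a unit, p divides k, and α^k is in F as well.
lemma exists_unit_eq_of_ramified [NeZero p] (h : IsKummerGenerator p σ α ζ a) (hp : p.Prime)
    (hodd : Odd p) {y : E} (hy : A.valuation y = 1) :
    ∃ (f : F) (e : E), A.valuation (algebraMap F E f) = 1 ∧ A.valuation (e - 1) < 1 ∧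
      y = algebraMap F E f * e ^ p := by
  have hy0 : y ≠ 0 := by rintro rfl; simp at hy
  obtain ⟨k, f, e, rfl⟩ := h.exists_eq_mul_pow hp hodd
    (fun y hy => h.exists_norm_eq_of_ramified hprin hA hp hodd hy) hy0
  have he0 : e ≠ 0 := by rintro rfl; simp [hp.ne_zero] at hy0
  have hf0 : f ≠ 0 := by rintro rfl; simp at hy0
  obtain ⟨i, c, ε, hc, hε, rfl⟩ := h.exists_eq_mul_one_add hA hp he0
  have ha0 : a ≠ 0 := by
    rintro rfl; exact h.not_pow 0 (zero_pow hp.ne_zero)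
  have hw1 : A.valuation (1 + ε) = 1 := Valuation.map_one_add_of_lt _ hε
  have e1 : α ^ k * algebraMap F E f * (algebraMap F E c * α ^ i * (1 + ε)) ^ p =
      algebraMap F E (f * c ^ p * a ^ i) * α ^ k * (1 + ε) ^ p := by
    simp only [mul_pow, map_mul, map_pow, ← h.pow_eq]
    ring
  rw [e1, map_mul, map_pow (A.valuation) (1 + ε), hw1, one_pow, mul_one] at hy
  have hdvd : p ∣ k := by
    by_contra hcon
    exact h.valuation_mul_pow_ne_one hA hp (mul_ne_zero (mul_ne_zero hf0 (pow_ne_zero _ hc))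
      (pow_ne_zero _ ha0)) hcon hy
  obtain ⟨q, rfl⟩ := hdvd
  rw [pow_mul, h.pow_eq, ← map_pow, ← map_mul] at hy
  refine ⟨_, 1 + ε, hy, by rwa [add_sub_cancel_left], ?_⟩
  rw [e1, pow_mul α, h.pow_eq, ← map_pow, ← map_mul]

include hprin hcyc hA in
lemma isRigidValuation_of_ramified [NeZero p] (h : IsKummerGenerator p σ α ζ a) (hp : p.Prime)
    (hodd : Odd p) : IsRigidValuation p A where
  principal := by
    intro x hx
    obtain ⟨f, e, hf, he, hy⟩ := h.exists_unit_eq_of_ramified hprin hA hp hodd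
      (Valuation.map_one_add_of_lt _ hx)
    -- Both 1 + x = f e^p and e^p are principal units, so f is one too.
    obtain ⟨d, hd⟩ := hprin (f - 1) (by
      have : algebraMap F E (f - 1) = x - algebraMap F E f * (e ^ p - 1) := by
        rw [map_sub, map_one]; linear_combination -hy
      rw [this]
      refine Valuation.map_sub_lt _ hx ?_
      rw [map_mul, hf, one_mul]
      exact valuation_pow_sub_one_lt _ he p)
    refine ⟨algebraMap F E d * e, ?_⟩
    rw [mul_pow, ← map_pow, hd, hy]
    congr 2
    ring
  cyclic := by
    intro x y hx hy hxp
    obtain ⟨f, e, hf, he, rfl⟩ := h.exists_unit_eq_of_ramified hprin hA hp hodd hx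
    obtain ⟨g, e', hg, he', rfl⟩ := h.exists_unit_eq_of_ramified hprin hA hp hodd hy
    obtain ⟨k, c, hk⟩ := hcyc f g hf hg (by
      rintro c rfl
      exact hxp (algebraMap F E c * e) (by rw [mul_pow, map_pow]))
    have he0 : e ≠ 0 := by
      rintro rfl
      simp [hp.ne_zero] at hx
    refine ⟨k, algebraMap F E c * e' / e ^ k, ?_⟩
    rw [hk, map_mul, map_pow, map_pow, mul_pow, div_pow, mul_pow]
    field_simp
    ring

end Ramified

section Unramified

variable (hα : A.valuation α = 1)

lemma valuation_algebraMap_eq_one (h : IsKummerGenerator p σ α ζ a) (hα : A.valuation α = 1) :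
    A.valuation (algebraMap F E a) = 1 := by
  rw [← h.pow_eq, map_pow, hα, one_pow]

include hprin hα in
-- The residue of α has degree p over the residue field of F, so its powers below p are linearly
-- independent there, and a combination with some nonzero reduced coefficient cannot reduce to 0.
lemma valuation_sum_eq_one (h : IsKummerGenerator p σ α ζ a) (hp : p.Prime) {c : ℕ → F}
    (hc : ∀ j < p, A.valuation (algebraMap F E (c j)) ≤ 1) {i : ℕ} (hi : i < p)
    (hci : A.valuation (algebraMap F E (c i)) = 1) :
    A.valuation (∑ j ∈ Finset.range p, algebraMap F E (c j) * α ^ j) = 1 := by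
  have hle : A.valuation (∑ j ∈ Finset.range p, algebraMap F E (c j) * α ^ j) ≤ 1 := by
    refine Valuation.map_sum_le _ fun j hj => ?_
    rw [map_mul, map_pow, hα, one_pow, mul_one]
    exact hc j (Finset.mem_range.1 hj)
  refine hle.eq_of_not_lt fun hlt => ?_
  let B := A.comap (algebraMap F E)
  let φ : B →+* A := ((algebraMap F E).comp B.subtype).codRestrict A.toSubring fun x => x.2
  have hφ : IsLocalHom φ := by
    refine ⟨fun x hx => ?_⟩
    have hx1 : A.valuation (algebraMap F E x) = 1 := (A.valuation_eq_one_iff (φ x)).1 hx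
    have hx0 : (x : F) ≠ 0 := by intro h0; rw [h0] at hx1; simp at hx1
    have hinv : (x : F)⁻¹ ∈ B := by
      change algebraMap F E (x : F)⁻¹ ∈ A
      rw [← A.valuation_le_one_iff, map_inv₀, map_inv₀, hx1, inv_one]
    exact IsUnit.of_mul_eq_one ⟨_, hinv⟩ (Subtype.ext (mul_inv_cancel₀ hx0))
  have hmem : ∀ x : F, A.valuation (algebraMap F E x) ≤ 1 → x ∈ B := fun x hx =>
    (A.valuation_le_one_iff _).1 hx
  have hresB : ∀ x : B, IsLocalRing.residue B x = 0 ↔ A.valuation (algebraMap F E x) < 1 := by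
    intro x
    rw [IsLocalRing.residue_eq_zero_iff, IsLocalRing.mem_maximalIdeal, ← map_mem_nonunits_iff φ]
    exact A.valuation_lt_one_iff (φ x)
  have hresA : ∀ x : A, IsLocalRing.residue A x = 0 ↔ A.valuation (x : E) < 1 := by
    intro x
    rw [IsLocalRing.residue_eq_zero_iff]
    exact A.valuation_lt_one_iff x
  let ψ := IsLocalRing.ResidueField.map φ
  have hψ : ∀ x : B, ψ (IsLocalRing.residue B x) = IsLocalRing.residue A (φ x) := fun x =>
    IsLocalRing.ResidueField.map_residue φ x
  let c' : ℕ → B := fun j => if hj : j < p then ⟨c j, hmem _ (hc j hj)⟩ else 0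
  have hc' : ∀ j < p, (c' j : F) = c j := fun j hj => by simp only [c', dif_pos hj]
  let α' : A := ⟨α, (A.valuation_le_one_iff _).1 hα.le⟩
  have ha1 : A.valuation (algebraMap F E a) = 1 := h.valuation_algebraMap_eq_one hα
  let a' : B := ⟨a, hmem a ha1.le⟩
  let f : (IsLocalRing.ResidueField B)[X] :=
    ∑ j ∈ Finset.range p, C (IsLocalRing.residue B (c' j)) * X ^ j
  have hf : f.eval₂ ψ (IsLocalRing.residue A α') = 0 := by
    simp only [f, eval₂_finsetSum, eval₂_mul, eval₂_C, eval₂_X_pow, hψ, ← map_pow, ← map_mul,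
      ← map_sum]
    rw [hresA]
    convert hlt using 2
    rw [← A.subtype_apply, map_sum]
    refine Finset.sum_congr rfl fun j hj => ?_
    rw [map_mul, map_pow]
    change algebraMap F E (c' j) * α ^ j = _
    rw [hc' j (Finset.mem_range.1 hj)]
  have hdeg : f.degree < p := by
    rw [← mem_degreeLT]
    refine Submodule.sum_mem _ fun j hj => mem_degreeLT.2 ?_
    exact (degree_C_mul_X_pow_le _ _).trans_lt (by exact_mod_cast Finset.mem_range.1 hj)
  have hcoeff : f.coeff i ≠ 0 := by
    simp only [f, finsetSum_coeff, coeff_C_mul_X_pow]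
    rw [Finset.sum_ite_eq, if_pos (Finset.mem_range.2 hi), Ne, hresB, hc' i hi, hci]
    exact lt_irrefl _
  have hf0 : f ≠ 0 := by rintro h0; rw [h0] at hcoeff; simp at hcoeff
  -- If the residue of a were b^p, then a / b^p would be a principal unit, hence a p-th power, and
  -- so would a.
  have hirr : Irreducible (X ^ p - C (IsLocalRing.residue B a')) := by
    refine X_pow_sub_C_irreducible_of_prime hp fun b hb => ?_
    obtain ⟨b, rfl⟩ := IsLocalRing.residue_surjective b
    rw [← sub_eq_zero, ← map_pow, ← map_sub, hresB] at hb
    have hb' : A.valuation (algebraMap F E ((b : F) ^ p - a)) < 1 := hb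
    have hbu : A.valuation (algebraMap F E ((b : F) ^ p)) = 1 := by
      rw [show (b : F) ^ p = a + ((b : F) ^ p - a) by ring, map_add,
        Valuation.map_add_eq_of_lt_left _ (by rw [ha1]; exact hb'), ha1]
    have hb0 : (b : F) ≠ 0 := by
      intro h0; rw [h0, zero_pow hp.ne_zero] at hbu; simp at hbu
    have hbp : (b : F) ^ p ≠ 0 := pow_ne_zero _ hb0
    obtain ⟨d, hd⟩ := hprin (a / (b : F) ^ p - 1) (by
      rw [show a / (b : F) ^ p - 1 = -(((b : F) ^ p - a) / (b : F) ^ p) by field_simp; ring,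
        map_neg, Valuation.map_neg, map_div₀, map_div₀, hbu, div_one]
      exact hb')
    refine h.not_pow (d * b) ?_
    rw [mul_pow, hd]
    field_simp
    ring
  have hg : (X ^ p - C (IsLocalRing.residue B a')).eval₂ ψ (IsLocalRing.residue A α') = 0 := by
    rw [eval₂_sub, eval₂_X_pow, eval₂_C, hψ, ← map_pow, sub_eq_zero]
    congr 1
    exact Subtype.ext h.pow_eq
  have hndvd : ¬ (X ^ p - C (IsLocalRing.residue B a')) ∣ f := by
    intro hd
    have := degree_le_of_dvd hd hf0
    rw [degree_X_pow_sub_C hp.pos] at this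
    exact absurd hdeg (not_lt.2 this)
  obtain ⟨u, v, huv⟩ := (hirr.coprime_iff_not_dvd).2 hndvd
  have := congrArg (eval₂ ψ (IsLocalRing.residue A α')) huv
  rw [eval₂_add, eval₂_mul, eval₂_mul, hf, hg, mul_zero, mul_zero, add_zero, eval₂_one] at this
  exact zero_ne_one this

include hprin hα in
lemma exists_eq_mul_unit_of_sum (h : IsKummerGenerator p σ α ζ a) (hp : p.Prime) (c : ℕ → F)
    (hc : ∃ j < p, c j ≠ 0) : ∃ i < p, c i ≠ 0 ∧
      (∀ j < p, A.valuation (algebraMap F E (c j)) ≤ A.valuation (algebraMap F E (c i))) ∧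
      A.valuation (∑ j ∈ Finset.range p, algebraMap F E (c j) * α ^ j) =
        A.valuation (algebraMap F E (c i)) := by
  obtain ⟨i, hi, hmax⟩ := (Finset.range p).exists_max_image
    (fun j => A.valuation (algebraMap F E (c j))) ⟨0, Finset.mem_range.2 hp.pos⟩
  have hci : c i ≠ 0 := by
    intro h0
    obtain ⟨j, hj, hcj⟩ := hc
    have := hmax j (Finset.mem_range.2 hj)
    simp only [h0, map_zero, le_zero_iff, map_eq_zero] at this
    exact hcj this
  have hci' : algebraMap F E (c i) ≠ 0 := by simpa using hci
  have hv : A.valuation (algebraMap F E (c i)) ≠ 0 := (A.valuation.ne_zero_iff).2 hci'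
  refine ⟨i, Finset.mem_range.1 hi, hci, fun j hj => hmax j (Finset.mem_range.2 hj), ?_⟩
  have h1 := h.valuation_sum_eq_one hprin hα hp (c := fun j => c j / c i) (fun j hj => by
    rw [map_div₀, map_div₀]
    exact div_le_one_of_le₀ (hmax j (Finset.mem_range.2 hj)) zero_le) (Finset.mem_range.1 hi)
    (by rw [div_self hci, map_one, map_one])
  have h2 : ∑ j ∈ Finset.range p, algebraMap F E (c j) * α ^ j =
      algebraMap F E (c i) * ∑ j ∈ Finset.range p, algebraMap F E (c j / c i) * α ^ j := by
    rw [Finset.mul_sum]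
    refine Finset.sum_congr rfl fun j _ => ?_
    rw [map_div₀]; field_simp
  rw [h2, map_mul, h1, mul_one]

include hprin hα in
lemma isGaussGenerator_of_unramified (h : IsKummerGenerator p σ α ζ a) (hp : p.Prime) :
    IsGaussGenerator p F A.valuation α := by
  intro c i hi
  rw [map_mul, map_pow, hα, one_pow, mul_one]
  by_cases hci : c i = 0
  · rw [hci, map_zero, map_zero]; exact zero_le
  obtain ⟨j, hj, -, hmax, heq⟩ := h.exists_eq_mul_unit_of_sum hprin hα hp c ⟨i, hi, hci⟩
  rw [heq]
  exact hmax i hi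

include hprin hα in
lemma exists_eq_mul_unit (h : IsKummerGenerator p σ α ζ a) (hp : p.Prime) {y : E} (hy : y ≠ 0) :
    ∃ (c : F) (u : E), c ≠ 0 ∧ A.valuation u = 1 ∧ y = algebraMap F E c * u := by
  obtain ⟨c, rfl⟩ := h.exists_sum y
  obtain ⟨i, hi, hci, -, heq⟩ := h.exists_eq_mul_unit_of_sum hprin hα hp c (by
    by_contra! hcon
    refine hy (Finset.sum_eq_zero fun j hj => ?_)
    rw [hcon j (Finset.mem_range.1 hj), map_zero, zero_mul])
  have hci' : algebraMap F E (c i) ≠ 0 := by simpa using hci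
  refine ⟨c i, (∑ j ∈ Finset.range p, algebraMap F E (c j) * α ^ j) / algebraMap F E (c i), hci,
    ?_, by rw [mul_div_cancel₀ _ hci']⟩
  rw [map_div₀, heq, div_self]
  exact (A.valuation.ne_zero_iff).2 hci'

include hprin hcyc hα in
lemma exists_norm_eq_of_unramified [NeZero p] (h : IsKummerGenerator p σ α ζ a) (hp : p.Prime)
    {y : E} (hy : y ≠ 0) : ∃ (k : ℕ) (c : F), Algebra.norm F y = a ^ k * c ^ p := by
  obtain ⟨c, u, hc, hu, rfl⟩ := h.exists_eq_mul_unit hprin hα hp hy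
  obtain ⟨k, d, hd⟩ := hcyc a (Algebra.norm F u) (h.valuation_algebraMap_eq_one hα)
    (h.valuation_norm_eq_one (h.isGaussGenerator_of_unramified hprin hα hp) hu) h.not_pow
  refine ⟨k, c * d, ?_⟩
  rw [map_mul, h.norm_algebraMap, hd]
  ring

include hprin hcyc hα in
-- Write y = α^k f (c u)^p with u a unit. The factor f c^p is a unit from F, hence of the form a^m
-- d^p = (α^m d)^p.
lemma exists_unit_eq_of_unramified [NeZero p] (h : IsKummerGenerator p σ α ζ a) (hp : p.Prime)
    (hodd : Odd p) {y : E} (hy : A.valuation y = 1) : ∃ (k : ℕ) (e : E), y = α ^ k * e ^ p := by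
  have hy0 : y ≠ 0 := by rintro rfl; simp at hy
  obtain ⟨k, f, e, rfl⟩ := h.exists_eq_mul_pow hp hodd
    (fun y hy => h.exists_norm_eq_of_unramified hprin hcyc hα hp hy) hy0
  have he0 : e ≠ 0 := by rintro rfl; simp [hp.ne_zero] at hy0
  obtain ⟨c, u, hc, hu, rfl⟩ := h.exists_eq_mul_unit hprin hα hp he0
  have e1 : α ^ k * algebraMap F E f * (algebraMap F E c * u) ^ p =
      α ^ k * u ^ p * algebraMap F E (f * c ^ p) := by
    simp only [mul_pow, map_mul, map_pow]
    ring
  rw [e1, map_mul, map_mul, map_pow, map_pow, hα, hu, one_pow, one_pow, one_mul, one_mul] at hy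
  obtain ⟨m, d, hd⟩ := hcyc a (f * c ^ p) (h.valuation_algebraMap_eq_one hα) hy h.not_pow
  refine ⟨k, u * α ^ m * algebraMap F E d, ?_⟩
  rw [e1, hd, map_mul, map_pow, map_pow, ← h.pow_eq]
  ring

include hprin hcyc hα in
lemma isRigidValuation_of_unramified [NeZero p] (h : IsKummerGenerator p σ α ζ a) (hp : p.Prime)
    (hodd : Odd p) : IsRigidValuation p A where
  principal := by
    intro x hx
    obtain ⟨k, e, hy⟩ := h.exists_unit_eq_of_unramified hprin hcyc hα hp hodd
      (Valuation.map_one_add_of_lt _ hx)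
    obtain ⟨c, hc⟩ := h.exists_norm_one_add_eq hprin
      (h.isGaussGenerator_of_unramified hprin hα hp) hx
    -- The norm of 1 + x is a p-th power and equals a^k N(e)^p; with k prime to p this would make a
    -- a p-th power.
    have hk : p ∣ k := by
      by_contra hcon
      obtain ⟨m, n, hmn⟩ := exists_mul_eq_one_add_mul hp hcon
      rw [hy, map_mul, map_pow, map_pow, h.norm_generator hodd] at hc
      have ha0 : a ≠ 0 := by
        rintro rfl; exact h.not_pow 0 (zero_pow hp.ne_zero)
      have hN0 : Algebra.norm F e ≠ 0 := by
        intro h0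
        have := h.norm_eq e
        rw [h0, map_zero, eq_comm, Finset.prod_eq_zero_iff] at this
        obtain ⟨i, _, hi⟩ := this
        have he0 := (map_eq_zero_iff _ (σ ^ i).injective).1 hi
        rw [he0, zero_pow hp.ne_zero, mul_zero] at hy
        have := Valuation.map_one_add_of_lt A.valuation hx
        rw [hy, map_zero] at this
        exact zero_ne_one this
      refine h.not_pow (c ^ m / (Algebra.norm F e ^ m * a ^ n)) ?_
      have h1 : (c ^ p) ^ m = (a ^ k * Algebra.norm F e ^ p) ^ m := by rw [hc]
      rw [mul_pow, ← pow_mul a, hmn] at h1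
      rw [div_pow, ← pow_mul, mul_comm m p, pow_mul, h1, mul_pow]
      have : Algebra.norm F e ^ m ≠ 0 := pow_ne_zero _ hN0
      rw [div_eq_iff (by positivity)]
      ring
    obtain ⟨q, rfl⟩ := hk
    exact ⟨α ^ q * e, by rw [hy]; ring⟩
  cyclic := by
    intro x y hx hy hxp
    obtain ⟨k, e, rfl⟩ := h.exists_unit_eq_of_unramified hprin hcyc hα hp hodd hx
    obtain ⟨l, e', rfl⟩ := h.exists_unit_eq_of_unramified hprin hcyc hα hp hodd hy
    have hk : ¬ p ∣ k := by
      rintro ⟨q, rfl⟩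
      exact hxp (α ^ q * e) (by ring)
    obtain ⟨m, n, hmn⟩ := exists_mul_eq_one_add_mul hp hk
    have hα0 := h.ne_zero hp.ne_zero
    have he0 : e ≠ 0 := by
      rintro rfl
      simp [hp.ne_zero] at hx
    refine ⟨m * l, e' / (e ^ (m * l) * α ^ (n * l)), ?_⟩
    have h1 : (α ^ k) ^ (m * l) = α ^ l * (α ^ (n * l)) ^ p := by
      rw [← pow_mul, ← mul_assoc, hmn]
      ring
    rw [mul_pow, h1, div_pow, mul_pow]
    field_simp
    ring

end Unramified

theorem isSteinbergRigid_and_exists_eq [Fact p.Prime] (h : IsKummerGenerator p σ α ζ a)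
    (hodd : Odd p) (hF : IsSteinbergRigid p F) :
    IsSteinbergRigid p E ∧ ∀ x : E, x ≠ 0 →
      ∃ (k : ℕ) (c : F) (e : E), x = α ^ k * algebraMap F E c * e ^ p := by
  have hp : p.Prime := Fact.out
  obtain ⟨O, hO⟩ := hF.exists_isRigidValuation hodd
  obtain ⟨A, hA1, hA2⟩ := exists_valuationSubring_extension (E := E) O
  have hprin : ∀ x : F, A.valuation (algebraMap F E x) < 1 → ∃ c : F, c ^ p = 1 + x :=
    fun x hx => hO.principal x ((hA1 x).1 hx)
  have hcyc : ∀ x y : F, A.valuation (algebraMap F E x) = 1 →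
      A.valuation (algebraMap F E y) = 1 → (∀ c : F, c ^ p ≠ x) →
      ∃ (k : ℕ) (c : F), y = x ^ k * c ^ p :=
    fun x y hx hy => hO.cyclic x y ((hA2 x).1 hx) ((hA2 y).1 hy)
  by_cases hA : ∀ c : F, c ≠ 0 → A.valuation (algebraMap F E (c ^ p * a)) ≠ 1
  · exact ⟨(h.isRigidValuation_of_ramified hprin hcyc hA hp hodd).isSteinbergRigid hodd,
      fun x hx => h.exists_eq_mul_pow hp hodd
        (fun y hy => h.exists_norm_eq_of_ramified hprin hA hp hodd hy) hx⟩
  · push Not at hA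
    -- Some d^p a is a unit, so dα is a unit: the unramified case for the rescaled generator.
    obtain ⟨d, hd, hda⟩ := hA
    have h' := h.scale hd
    have hα : A.valuation (algebraMap F E d * α) = 1 := by
      rw [← h'.pow_eq, map_pow] at hda
      exact (pow_eq_one_iff_of_nonneg zero_le hp.ne_zero).1 hda
    refine ⟨(h'.isRigidValuation_of_unramified hprin hcyc hα hp hodd).isSteinbergRigid hodd,
      fun x hx => ?_⟩
    obtain ⟨k, c, e, hx⟩ := h'.exists_eq_mul_pow hp hodd
      (fun y hy => h'.exists_norm_eq_of_unramified hprin hcyc hα hp hy) hx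
    refine ⟨k, d ^ k * c, e, ?_⟩
    rw [hx, mul_pow, map_mul, map_pow]
    ring

end IsKummerGenerator

end Ascent

open IntermediateField

/-! ### The tower of p-th root extensions and the Galois action on power classes -/

section Tower

variable {p : ℕ} {F Ω : Type*} [Field F] [Field Ω] [Algebra F Ω]

lemma isSteinbergRigid_iff (K : IntermediateField F Ω) : IsSteinbergRigid p K ↔
    ∀ x ∈ K, (∀ c ∈ K, c ^ p ≠ x) → ∃ (k : ℕ), ∃ c ∈ K, 1 - x = x ^ k * c ^ p := by
  constructor
  · intro h x hx hxp
    obtain ⟨k, c, hk⟩ := h ⟨x, hx⟩ fun c hc => hxp c c.2 (congrArg Subtype.val hc)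
    exact ⟨k, c, c.2, congrArg Subtype.val hk⟩
  · intro h x hxp
    obtain ⟨k, c, hc, hk⟩ := h x x.2 fun c hc hcx => hxp ⟨c, hc⟩ (Subtype.ext hcx)
    exact ⟨k, ⟨c, hc⟩, Subtype.ext hk⟩

lemma adjoin_gen_eq_top (K : IntermediateField F Ω) (α : Ω) :
    IntermediateField.adjoin K {AdjoinSimple.gen K α} = ⊤ := by
  apply lift_injective
  rw [lift_adjoin_simple, lift_top, AdjoinSimple.coe_gen]

variable [Fact p.Prime]

lemma mem_of_pow_eq_pow {ζ : F} (hζ : IsPrimitiveRoot ζ p) (K : IntermediateField F Ω) {α c : Ω}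
    (hc : c ∈ K) (h : α ^ p = c ^ p) : α ∈ K := by
  have hp : p.Prime := Fact.out
  rcases eq_or_ne c 0 with rfl | hc0
  · rw [zero_pow hp.ne_zero] at h
    rw [eq_zero_of_pow_eq_zero h]; exact zero_mem _
  have h1 : (α / c) ^ p = 1 := by rw [div_pow, h, div_self (pow_ne_zero _ hc0)]
  obtain ⟨i, -, hi⟩ := (hζ.map_of_injective (algebraMap F Ω).injective).eq_pow_of_pow_eq_one h1
  rw [eq_div_iff hc0] at hi
  rw [← hi]
  exact mul_mem (pow_mem (K.algebraMap_mem ζ) _) hc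

omit [Fact p.Prime] in
lemma primitiveRoot_map {ζ : F} (hζ : IsPrimitiveRoot ζ p) (K : IntermediateField F Ω) :
    IsPrimitiveRoot (algebraMap F K ζ) p :=
  hζ.map_of_injective (algebraMap F K).injective

section Step

variable {ζ : F} (hζ : IsPrimitiveRoot ζ p) (K : IntermediateField F Ω) {α : Ω}
  (hα : α ^ p ∈ K) (hαK : α ∉ K)

include hζ hαK in
lemma not_pow_of_notMem (c : K) : c ^ p ≠ (⟨α ^ p, hα⟩ : K) := fun hc =>
  hαK (mem_of_pow_eq_pow hζ K c.2 (congrArg Subtype.val hc).symm)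

omit [Fact p.Prime] in
lemma gen_pow_eq : AdjoinSimple.gen K α ^ p = algebraMap K K⟮α⟯ ⟨α ^ p, hα⟩ :=
  Subtype.ext rfl

include hζ hα hαK in
lemma isGaloisOfDegree_adjoin :
    IsGaloisOfDegree p K (IntermediateField.adjoin F ((K : Set Ω) ∪ {α})) := by
  rw [← restrictScalars_adjoin]
  refine ⟨fun x hx => K⟮α⟯.algebraMap_mem ⟨x, hx⟩, ?_, ?_⟩
  · exact isGalois_of_pow_eq (primitiveRoot_map hζ K) (gen_pow_eq K hα)
      (not_pow_of_notMem hζ K hα hαK) (adjoin_gen_eq_top K α)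
  · exact finrank_eq_of_pow_eq (gen_pow_eq K hα)
      (not_pow_of_notMem hζ K hα hαK) (adjoin_gen_eq_top K α)

include hζ hα in
lemma IsSteinbergRigid.adjoin_pRoot (hodd : Odd p) (hK : IsSteinbergRigid p K) :
    IsSteinbergRigid p (IntermediateField.adjoin F ((K : Set Ω) ∪ {α})) ∧
    ∀ x ∈ IntermediateField.adjoin F ((K : Set Ω) ∪ {α}), x ≠ 0 → ∃ (k : ℕ), ∃ c ∈ K,
      ∃ e ∈ IntermediateField.adjoin F ((K : Set Ω) ∪ {α}), x = α ^ k * c * e ^ p := by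
  by_cases hαK : α ∈ K
  · have : IntermediateField.adjoin F ((K : Set Ω) ∪ {α}) = K := by
      rw [Set.union_eq_self_of_subset_right (Set.singleton_subset_iff.2 hαK), adjoin_self]
    rw [this]
    exact ⟨hK, fun x hx _ => ⟨0, x, hx, 1, one_mem _, by simp⟩⟩
  · rw [← restrictScalars_adjoin]
    obtain ⟨σ, hσ⟩ := exists_isKummerGenerator (primitiveRoot_map hζ K) (gen_pow_eq K hα)
      (not_pow_of_notMem hζ K hα hαK) (adjoin_gen_eq_top K α)
    obtain ⟨h1, h2⟩ := hσ.isSteinbergRigid_and_exists_eq hodd hK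
    refine ⟨h1, fun x hx hx0 => ?_⟩
    obtain ⟨k, c, e, hk⟩ := h2 ⟨x, hx⟩ fun h0 => hx0 (congrArg Subtype.val h0)
    exact ⟨k, c, c.2, e, e.2, congrArg Subtype.val hk⟩

end Step

/-- The field generated by the `p`-th roots of the elements of `K`. -/
def pRootExtension (p : ℕ) (K : IntermediateField F Ω) : IntermediateField F Ω :=
  IntermediateField.adjoin F {x | x ^ p ∈ K}

omit [Fact p.Prime] in
lemma mem_pRootExtension {K : IntermediateField F Ω} {x : Ω} (hx : x ^ p ∈ K) :
    x ∈ pRootExtension p K :=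
  subset_adjoin F _ hx

omit [Fact p.Prime] in
lemma le_pRootExtension (K : IntermediateField F Ω) : K ≤ pRootExtension p K := fun _ hx =>
  mem_pRootExtension (pow_mem hx p)

omit [Fact p.Prime] in
lemma kummerExt_eq : kummerExt p F Ω = pRootExtension p ⊥ := by
  rw [kummerExt, pRootExtension]
  congr 1
  ext x
  simp only [Set.mem_ofPred_eq, IntermediateField.mem_bot, Set.mem_range]
  exact exists_congr fun a => eq_comm

section FiniteLevel

variable {ζ : F} (hζ : IsPrimitiveRoot ζ p) (hodd : Odd p) {K : IntermediateField F Ω}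
  (hK : IsSteinbergRigid p K)

include hζ hodd hK in
-- The roots are adjoined one at a time. The second claim is carried along because the new factor
-- α^k and the old r both have their p-th power in `K` itself, not merely in the intermediate field.
lemma IsSteinbergRigid.adjoin_finset (t : Finset Ω) (ht : ∀ α ∈ t, α ^ p ∈ K) :
    IsSteinbergRigid p (IntermediateField.adjoin F ((K : Set Ω) ∪ t)) ∧
    ∀ x ∈ IntermediateField.adjoin F ((K : Set Ω) ∪ t), x ≠ 0 →
      ∃ r ∈ IntermediateField.adjoin F ((K : Set Ω) ∪ t),
      ∃ e ∈ IntermediateField.adjoin F ((K : Set Ω) ∪ t), r ^ p ∈ K ∧ x = r * e ^ p := by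
  classical
  induction t using Finset.induction_on with
  | empty =>
    rw [Finset.coe_empty, Set.union_empty, adjoin_self]
    exact ⟨hK, fun x hx _ => ⟨x, hx, 1, one_mem _, pow_mem hx p, by simp⟩⟩
  | insert α t _ ih =>
    obtain ⟨h1, h2⟩ := ih fun β hβ => ht β (Finset.mem_insert_of_mem hβ)
    set L := IntermediateField.adjoin F ((K : Set Ω) ∪ t) with hL
    have hKL : K ≤ L := fun x hx => subset_adjoin F _ (Or.inl hx)
    have hαL : α ^ p ∈ L := hKL (ht α (Finset.mem_insert_self _ _))
    have heq : IntermediateField.adjoin F ((K : Set Ω) ∪ ↑(insert α t)) =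
        IntermediateField.adjoin F ((L : Set Ω) ∪ {α}) := by
      rw [Finset.coe_insert, Set.insert_eq, Set.union_comm {α}, ← Set.union_assoc,
        adjoin_union, ← hL, adjoin_union, adjoin_self]
    rw [heq]
    obtain ⟨h3, h4⟩ := h1.adjoin_pRoot hζ L hαL hodd
    refine ⟨h3, fun x hx hx0 => ?_⟩
    obtain ⟨k, c, hc, e, he, hxe⟩ := h4 x hx hx0
    have hc0 : c ≠ 0 := by rintro rfl; simp at hxe; exact hx0 hxe
    obtain ⟨r, hr, e', he', hrp, hce⟩ := h2 c hc hc0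
    have hLL : L ≤ IntermediateField.adjoin F ((L : Set Ω) ∪ {α}) :=
      fun x hx => subset_adjoin F _ (Or.inl hx)
    have hαM : α ∈ IntermediateField.adjoin F ((L : Set Ω) ∪ {α}) :=
      subset_adjoin F _ (Or.inr rfl)
    refine ⟨α ^ k * r, mul_mem (pow_mem hαM k) (hLL hr), e' * e, mul_mem (hLL he') he, ?_, ?_⟩
    · rw [mul_pow, ← pow_mul, mul_comm k p, pow_mul]
      exact mul_mem (pow_mem (ht α (Finset.mem_insert_self _ _)) k) hrp
    · rw [hxe, hce]; ring

omit [Fact p.Prime] in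
lemma exists_finset_of_mem_pRootExtension {x : Ω} (hx : x ∈ pRootExtension p K) :
    ∃ t : Finset Ω, (∀ α ∈ t, α ^ p ∈ K) ∧
      x ∈ IntermediateField.adjoin F ((K : Set Ω) ∪ t) ∧
      IntermediateField.adjoin F ((K : Set Ω) ∪ t) ≤ pRootExtension p K := by
  obtain ⟨t, ht, hxt⟩ := exists_finset_of_mem_adjoin hx
  refine ⟨t, fun α hα => ht hα, adjoin.mono F _ _ Set.subset_union_right hxt, ?_⟩
  rw [adjoin_le_iff]
  exact Set.union_subset (le_pRootExtension K) fun α hα => subset_adjoin F _ (ht hα)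

include hζ hodd hK in
lemma IsSteinbergRigid.exists_eq_of_mem_pRootExtension {x : Ω} (hx : x ∈ pRootExtension p K)
    (hx0 : x ≠ 0) : ∃ r ∈ pRootExtension p K, ∃ e ∈ pRootExtension p K,
      r ^ p ∈ K ∧ x = r * e ^ p := by
  obtain ⟨t, ht, hxt, hle⟩ := exists_finset_of_mem_pRootExtension hx
  obtain ⟨r, hr, e, he, h1, h2⟩ := (hK.adjoin_finset hζ hodd t ht).2 x hxt hx0
  exact ⟨r, hle hr, e, hle he, h1, h2⟩

include hζ hodd hK in
lemma IsSteinbergRigid.pRootExtension : IsSteinbergRigid p (pRootExtension p K) := by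
  rw [isSteinbergRigid_iff]
  intro x hx hxp
  obtain ⟨t, ht, hxt, hle⟩ := exists_finset_of_mem_pRootExtension hx
  obtain ⟨k, c, hc, hk⟩ := (isSteinbergRigid_iff _).1 (hK.adjoin_finset hζ hodd t ht).1 x hxt
    fun c hc => hxp c (hle hc)
  exact ⟨k, c, hle hc, hk⟩

end FiniteLevel

/-- The Galois group acts trivially on `K` modulo `p`-th powers. -/
def ActsTrivially (p : ℕ) (K : IntermediateField F Ω) : Prop :=
  ∀ (σ : Gal(Ω/F)), ∀ x ∈ K, ∃ e ∈ K, σ x = x * e ^ p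

omit [Fact p.Prime] in
lemma ActsTrivially.apply_mem {K : IntermediateField F Ω} (hK : ActsTrivially p K)
    (σ : Gal(Ω/F)) {x : Ω} (hx : x ∈ K) : σ x ∈ K := by
  obtain ⟨e, he, h⟩ := hK σ x hx
  rw [h]
  exact mul_mem hx (pow_mem he p)

omit [Fact p.Prime] in
lemma apply_mem_pRootExtension {K : IntermediateField F Ω}
    (hK : ∀ (σ : Gal(Ω/F)), ∀ x ∈ K, σ x ∈ K) (σ : Gal(Ω/F)) {x : Ω}
    (hx : x ∈ pRootExtension p K) : σ x ∈ pRootExtension p K := by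
  have : pRootExtension p K ≤ (pRootExtension p K).comap (σ : Ω →ₐ[F] Ω) := by
    conv_lhs => rw [RigidField.pRootExtension]
    rw [adjoin_le_iff]
    intro y hy
    refine mem_pRootExtension ?_
    change (σ y) ^ p ∈ K
    rw [← map_pow]
    exact hK σ _ hy
  exact this hx

/-- Modulo p-th powers x may be replaced by r with r^p in `K`. Then (σ r / r)^p = d^p with d in `K`,
so σ r / r is in `K`, and every element of `K` is a p-th power one level up. -/
lemma ActsTrivially.pRootExtension [IsSepClosure F Ω] {ζ : F} (hζ : IsPrimitiveRoot ζ p)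
    (hodd : Odd p) {K : IntermediateField F Ω} (hKr : IsSteinbergRigid p K)
    (hK : ActsTrivially p K) : ActsTrivially p (pRootExtension p K) := by
  have hp : p.Prime := Fact.out
  have : IsSepClosed Ω := IsSepClosure.sep_closed F
  have : NeZero (p : Ω) := by
    have := (hζ.map_of_injective (algebraMap F Ω).injective).neZero'
    exact this
  intro σ x hx
  rcases eq_or_ne x 0 with rfl | hx0
  · exact ⟨1, one_mem _, by simp⟩
  obtain ⟨r, hr, e, he, hrp, rfl⟩ := hKr.exists_eq_of_mem_pRootExtension hζ hodd hx hx0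
  have hr0 : r ≠ 0 := left_ne_zero_of_mul hx0
  have he0 : e ≠ 0 := by rintro rfl; simp [hp.ne_zero] at hx0
  obtain ⟨d, hd, hd'⟩ := hK σ _ hrp
  have hf : σ r / r ∈ K := by
    refine mem_of_pow_eq_pow hζ K hd ?_
    rw [div_pow, ← map_pow, hd', mul_div_cancel_left₀ _ (pow_ne_zero _ hr0)]
  obtain ⟨g, hg⟩ := IsSepClosed.exists_pow_nat_eq (σ r / r) p
  refine ⟨g * (σ e / e), mul_mem (mem_pRootExtension (hg ▸ hf)) (div_mem
    (apply_mem_pRootExtension (fun σ x hx => hK.apply_mem σ hx) σ he) he), ?_⟩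
  rw [map_mul, map_pow, mul_pow, hg, div_pow]
  field_simp

section Steps

variable {ζ : F} (hζ : IsPrimitiveRoot ζ p) {K L : IntermediateField F Ω}

include hζ in
lemma IsGaloisOfDegree.exists_eq_adjoin (h : IsGaloisOfDegree p K L) :
    ∃ α : Ω, α ^ p ∈ K ∧ α ∉ K ∧ L = IntermediateField.adjoin F ((K : Set Ω) ∪ {α}) := by
  have hp : p.Prime := Fact.out
  obtain ⟨hKL, hgal, hfr⟩ := h
  have : FiniteDimensional K (extendScalars hKL) :=
    Module.finite_of_finrank_pos (by rw [hfr]; exact hp.pos)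
  have : IsCyclic Gal((extendScalars hKL)/K) := by
    refine isCyclic_of_prime_card (p := p) ?_
    rw [IsGalois.card_aut_eq_finrank, hfr]
  obtain ⟨α, ⟨a, ha⟩, htop⟩ := exists_root_adjoin_eq_top_of_isCyclic K (extendScalars hKL)
    (by rw [hfr]; exact ⟨_, (mem_primitiveRoots hp.pos).2 (primitiveRoot_map hζ K)⟩)
  rw [hfr] at ha
  have h1 : (a : Ω) = (α : Ω) ^ p := congrArg Subtype.val ha
  have h2 : IntermediateField.adjoin K {(α : Ω)} = extendScalars hKL := by
    rw [← lift_adjoin_simple, htop, lift_top]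
  refine ⟨α, h1 ▸ a.2, fun hαK => ?_, ?_⟩
  · have h3 : extendScalars hKL = ⊥ := by
      rw [← h2, adjoin_simple_eq_bot_iff, IntermediateField.mem_bot]
      exact ⟨⟨α, hαK⟩, rfl⟩
    rw [h3, IntermediateField.finrank_bot] at hfr
    exact hp.one_lt.ne hfr
  · rw [← restrictScalars_adjoin, h2, extendScalars_restrictScalars]

include hζ in
-- This is Kummer theory over `K`, which contains the p-th roots of unity.
lemma curlyStep_eq_pRootExtension : curlyStep p K = pRootExtension p K := by
  apply le_antisymm
  · refine sup_le (le_pRootExtension K) (sSup_le fun L hL => ?_)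
    obtain ⟨α, hα, -, rfl⟩ := IsGaloisOfDegree.exists_eq_adjoin hζ hL
    rw [adjoin_le_iff]
    exact Set.union_subset (le_pRootExtension K)
      (Set.singleton_subset_iff.2 (mem_pRootExtension hα))
  · rw [pRootExtension, adjoin_le_iff]
    intro α hα
    by_cases hαK : α ∈ K
    · exact (le_sup_left : K ≤ curlyStep p K) hαK
    · refine (le_sup_right : _ ≤ curlyStep p K) ?_
      exact (le_sSup (isGaloisOfDegree_adjoin hζ K hα hαK) :
        IntermediateField.adjoin F ((K : Set Ω) ∪ {α}) ≤ _) (subset_adjoin F _ (Or.inr rfl))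

omit [Fact p.Prime] in
lemma roundStep_le_curlyStep : roundStep p K ≤ curlyStep p K :=
  sup_le_sup_left (sSup_le_sSup fun _ hL => hL.1) K

include hζ in
lemma ActsTrivially.isGalois [IsSepClosure F Ω] (hK : ActsTrivially p K)
    (h : IsGaloisOfDegree p K L) : IsGalois F L := by
  have hp : p.Prime := Fact.out
  obtain ⟨α, hα, hαK, rfl⟩ := IsGaloisOfDegree.exists_eq_adjoin hζ h
  have hn : Normal F (IntermediateField.adjoin F ((K : Set Ω) ∪ {α})) := by
    rw [normal_iff_forall_map_le']
    intro σ
    rw [adjoin_map, adjoin_le_iff]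
    rintro _ ⟨x, hx | rfl, rfl⟩
    · exact subset_adjoin F _ (Or.inl (hK.apply_mem σ hx))
    · obtain ⟨e, he, h1⟩ := hK σ _ hα
      refine mem_of_pow_eq_pow (c := x * e) hζ _ (mul_mem (subset_adjoin F _ (Or.inr rfl))
        (subset_adjoin F _ (Or.inl he))) ?_
      change (σ x) ^ p = _
      rw [← map_pow, h1, mul_pow]
  exact { to_isSeparable := Algebra.isSeparable_tower_bot_of_isSeparable F _ Ω, to_normal := hn }

include hζ in
lemma ActsTrivially.roundStep_eq_curlyStep [IsSepClosure F Ω] (hK : ActsTrivially p K) :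
    roundStep p K = curlyStep p K := by
  rw [roundStep, curlyStep]
  congr 3
  ext L
  exact ⟨fun h => h.1, fun h => ⟨h, hK.isGalois hζ h⟩⟩

end Steps

/-- Rigid elements have the Steinberg property. -/
lemma IsPRigid.isSteinbergRigid {ζ : F} (hζ : IsPrimitiveRoot ζ p) (h : IsPRigid p F) :
    IsSteinbergRigid p F := by
  have hp : p.Prime := Fact.out
  intro a ha
  have : Fact (Irreducible (X ^ p - C a)) := ⟨X_pow_sub_C_irreducible_of_prime hp ha⟩
  obtain ⟨σ, hσ⟩ := exists_isKummerGenerator (E := AdjoinRoot (X ^ p - C a)) hζ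
    (root_X_pow_sub_C_pow p a) ha (adjoin_root_eq_top _)
  obtain ⟨k, -, c, hc⟩ := (h a ha).2 (1 - AdjoinRoot.root (X ^ p - C a))
  exact ⟨k, c, by rw [← hc]; exact (hσ.norm_one_sub hp.pos).symm⟩

theorem IsPRigid.curlyField_eq_roundField [IsSepClosure F Ω] {ζ : F} (hζ : IsPrimitiveRoot ζ p)
    (hodd : Odd p) (h : IsPRigid p F) (n : ℕ) :
    curlyField p F Ω (n + 2) = roundField p F Ω (n + 2) := by
  have hbot : IsSteinbergRigid p (⊥ : IntermediateField F Ω) := by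
    rw [isSteinbergRigid_iff]
    intro x hx hxp
    obtain ⟨x, rfl⟩ := IntermediateField.mem_bot.1 hx
    obtain ⟨k, c, hk⟩ := h.isSteinbergRigid hζ x fun c hc =>
      hxp (algebraMap F Ω c) ((⊥ : IntermediateField F Ω).algebraMap_mem c) (by rw [← map_pow, hc])
    exact ⟨k, algebraMap F Ω c, (⊥ : IntermediateField F Ω).algebraMap_mem c, by
      rw [← map_one (algebraMap F Ω), ← map_sub, hk, map_mul, map_pow, map_pow]⟩
  have hbot' : ActsTrivially p (⊥ : IntermediateField F Ω) := by
    intro σ x hx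
    obtain ⟨x, rfl⟩ := IntermediateField.mem_bot.1 hx
    exact ⟨1, one_mem _, by simp⟩
  -- The Steinberg property and the trivial action have to be carried through the induction together
  -- with the equality.
  suffices H : curlyField p F Ω (n + 2) = roundField p F Ω (n + 2) ∧
      IsSteinbergRigid p (curlyField p F Ω (n + 2)) ∧
      ActsTrivially p (curlyField p F Ω (n + 2)) from H.1
  induction n with
  | zero =>
    refine ⟨rfl, ?_⟩
    change IsSteinbergRigid p (kummerExt p F Ω) ∧ ActsTrivially p (kummerExt p F Ω)
    rw [kummerExt_eq]
    exact ⟨hbot.pRootExtension hζ hodd, hbot'.pRootExtension hζ hodd hbot⟩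
  | succ n ih =>
    obtain ⟨h1, h2, h3⟩ := ih
    have h4 : curlyField p F Ω (n + 1 + 2) = curlyStep p (curlyField p F Ω (n + 2)) := rfl
    have h5 : roundField p F Ω (n + 1 + 2) = roundStep p (roundField p F Ω (n + 2)) := rfl
    rw [h4, h5, ← h1, h3.roundStep_eq_curlyStep hζ, curlyStep_eq_pRootExtension hζ]
    exact ⟨rfl, h2.pRootExtension hζ hodd, h3.pRootExtension hζ hodd h2⟩

end Tower

/-! ### The converse: centrality and norms -/

section Converse

variable {p : ℕ} {F Ω : Type*} [Field F] [Field Ω] [Algebra F Ω]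

lemma le_fixedField_zpowers_iff (L : IntermediateField F Ω) (g : Gal(Ω/F)) :
    L ≤ fixedField (Subgroup.zpowers g) ↔ ∀ x ∈ L, g x = x := by
  rw [IntermediateField.le_iff_le, Subgroup.zpowers_le, IntermediateField.mem_fixingSubgroup_iff]

lemma commutator_apply_eq_iff (σ τ : Gal(Ω/F)) (x : Ω) :
    ((σ * τ)⁻¹ * (τ * σ)) x = x ↔ τ (σ x) = σ (τ x) := by
  rw [AlgEquiv.mul_apply, AlgEquiv.mul_apply]
  constructor
  · intro h
    have := congrArg (σ * τ) h
    rwa [← AlgEquiv.mul_apply, mul_inv_cancel, AlgEquiv.one_apply, AlgEquiv.mul_apply] at this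
  · intro h
    rw [h, ← AlgEquiv.mul_apply σ, ← AlgEquiv.mul_apply, inv_mul_cancel, AlgEquiv.one_apply]

lemma eq_on_adjoin {S : Set Ω} {σ τ : Gal(Ω/F)} (h : ∀ x ∈ S, σ x = τ x) {x : Ω}
    (hx : x ∈ IntermediateField.adjoin F S) : σ x = τ x := by
  have h1 : (σ : Ω →ₐ[F] Ω).comp (val _) = (τ : Ω →ₐ[F] Ω).comp (val _) :=
    algHom_ext_of_eq_adjoin F (S := IntermediateField.adjoin F S) rfl
      (fun x hx => h x hx)
  exact DFunLike.congr_fun h1 ⟨x, hx⟩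

/-- Commutation of two automorphisms can be checked on generators. -/
lemma commute_on_adjoin {S : Set Ω} {σ τ : Gal(Ω/F)} (h : ∀ x ∈ S, τ (σ x) = σ (τ x)) {x : Ω}
    (hx : x ∈ IntermediateField.adjoin F S) : τ (σ x) = σ (τ x) :=
  (commutator_apply_eq_iff σ τ x).1 (eq_on_adjoin (τ := 1)
    (fun y hy => (commutator_apply_eq_iff σ τ y).2 (h y hy)) hx)

variable [Fact p.Prime] {ζ : F} (hζ : IsPrimitiveRoot ζ p)

include hζ in
lemma exists_apply_eq_mul (τ : Gal(Ω/F)) {x : Ω} (hx0 : x ≠ 0) (hx : τ (x ^ p) = x ^ p) :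
    ∃ i : ℕ, τ x = algebraMap F Ω (ζ ^ i) * x := by
  have h1 : (τ x / x) ^ p = 1 := by
    rw [div_pow, ← map_pow, hx, div_self (pow_ne_zero _ hx0)]
  obtain ⟨i, -, hi⟩ := (hζ.map_of_injective (algebraMap F Ω).injective).eq_pow_of_pow_eq_one h1
  exact ⟨i, by rw [map_pow, hi]; field_simp⟩

include hζ in
lemma commute_on_kummerExt (σ τ : Gal(Ω/F)) {x : Ω} (hx : x ∈ kummerExt p F Ω) :
    τ (σ x) = σ (τ x) := by
  refine commute_on_adjoin ?_ hx
  rintro y ⟨a, ha⟩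
  rcases eq_or_ne y 0 with rfl | hy0
  · simp
  obtain ⟨i, hi⟩ := exists_apply_eq_mul hζ τ hy0 (by rw [ha, AlgEquiv.commutes])
  obtain ⟨j, hj⟩ := exists_apply_eq_mul hζ σ hy0 (by rw [ha, AlgEquiv.commutes])
  rw [hi, hj, map_mul, map_mul, hi, hj, AlgEquiv.commutes, AlgEquiv.commutes]
  ring

include hζ in
lemma pow_apply_eq_on_kummerExt (σ : Gal(Ω/F)) {x : Ω} (hx : x ∈ kummerExt p F Ω) :
    (σ ^ p) x = x := by
  refine eq_on_adjoin (τ := 1) ?_ hx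
  rintro y ⟨a, ha⟩
  rcases eq_or_ne y 0 with rfl | hy0
  · simp
  obtain ⟨i, hi⟩ := exists_apply_eq_mul hζ σ hy0 (by rw [ha, AlgEquiv.commutes])
  rw [pow_apply_of_apply_eq hi, ← pow_mul, mul_comm i p, pow_mul, hζ.pow_eq_one, one_pow, map_one,
    one_mul, AlgEquiv.one_apply]

omit [Fact p.Prime] in
lemma apply_mem_kummerExt (σ : Gal(Ω/F)) {x : Ω} (hx : x ∈ kummerExt p F Ω) :
    σ x ∈ kummerExt p F Ω := by
  rw [kummerExt_eq] at hx ⊢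
  refine apply_mem_pRootExtension (fun σ x hx => ?_) σ hx
  obtain ⟨a, rfl⟩ := IntermediateField.mem_bot.1 hx
  rw [AlgEquiv.commutes]
  exact IntermediateField.algebraMap_mem _ a

include hζ in
/-- If `L = K(α)` is Galois over `F`, where `K` is the maximal Kummer extension of exponent `p` and
`α ^ p ∈ K`, then `Gal(L/K)` is central in `Gal(L/F)`. -/
lemma commute_on_generator {L : IntermediateField F Ω} (hL : ∀ (σ : Gal(Ω/F)), ∀ x ∈ L, σ x ∈ L)
    {α : Ω} (hα : α ^ p ∈ kummerExt p F Ω) (hα0 : α ≠ 0)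
    (hLα : L = IntermediateField.adjoin F ((kummerExt p F Ω : Set Ω) ∪ {α}))
    (σ : Gal(Ω/F)) {τ : Gal(Ω/F)} (hτ : ∀ x ∈ kummerExt p F Ω, τ x = x) :
    τ (σ α) = σ (τ α) := by
  have hp : p.Prime := Fact.out
  have hαL : α ∈ L := by rw [hLα]; exact subset_adjoin F _ (Or.inr rfl)
  have hLeq : ∀ ρ ρ' : Gal(Ω/F), (∀ x ∈ kummerExt p F Ω, ρ x = x) →
      (∀ x ∈ kummerExt p F Ω, ρ' x = x) → ρ α = ρ' α → ∀ x ∈ L, ρ x = ρ' x := by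
    intro ρ ρ' h1 h2 h3 x hx
    rw [hLα] at hx
    refine eq_on_adjoin ?_ hx
    rintro y (hy | rfl)
    · rw [h1 y hy, h2 y hy]
    · exact h3
  obtain ⟨i, hi⟩ := exists_apply_eq_mul hζ τ hα0 (hτ _ hα)
  by_cases hip : p ∣ i
  · have h1 : τ α = α := by
      rw [hi, (hζ.pow_eq_one_iff_dvd i).2 hip, map_one, one_mul]
    have h2 := hLeq τ 1 hτ (fun x _ => rfl) h1
    rw [h1, h2 _ (hL σ α hαL), AlgEquiv.one_apply]
  set η := ζ ^ i with hη
  have hηp : IsPrimitiveRoot η p :=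
    hζ.pow_of_coprime i ((Nat.Prime.coprime_iff_not_dvd hp).2 hip).symm
  -- This conjugate also fixes F^(2), so it acts on L as some τ^j. The aim is to show that η^j = η.
  set ρ : Gal(Ω/F) := σ⁻¹ * τ * σ with hρ
  have hρK : ∀ x ∈ kummerExt p F Ω, ρ x = x := by
    intro x hx
    rw [hρ, AlgEquiv.mul_apply, AlgEquiv.mul_apply, hτ _ (apply_mem_kummerExt σ hx),
      ← AlgEquiv.mul_apply, inv_mul_cancel, AlgEquiv.one_apply]
  have hσρ : ∀ x, σ (ρ x) = τ (σ x) := by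
    intro x
    rw [hρ, AlgEquiv.mul_apply, AlgEquiv.mul_apply, ← AlgEquiv.mul_apply σ, mul_inv_cancel,
      AlgEquiv.one_apply]
  obtain ⟨j, hj⟩ := exists_apply_eq_mul hηp ρ hα0 (hρK _ hα)
  have hτj : ∀ x ∈ kummerExt p F Ω, (τ ^ j) x = x := by
    intro x hx
    have := pow_apply_of_apply_eq (σ := τ) (α := x) (ζ := 1) (by rw [map_one, one_mul, hτ x hx]) j
    rwa [one_pow, map_one, one_mul] at this
  have hρτ : ∀ x ∈ L, ρ x = (τ ^ j) x :=
    hLeq _ _ hρK hτj (by rw [hj, pow_apply_of_apply_eq hi])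
  have hσL : ∀ n : ℕ, (σ ^ n) α ∈ L := fun n => hL _ _ hαL
  have key : ∀ n : ℕ, τ ((σ ^ n) α) = algebraMap F Ω (η ^ j ^ n) * (σ ^ n) α := by
    intro n
    induction n with
    | zero => simpa using hi
    | succ n ih =>
      rw [pow_succ', AlgEquiv.mul_apply, ← hσρ, hρτ _ (hσL n), pow_apply_of_apply_eq ih, map_mul,
        AlgEquiv.commutes, ← pow_mul, pow_succ]
  -- Since σ^p fixes F^(2), it multiplies α by a root of unity, so τ acts on σ^p α by the same
  -- factor η as on α. Comparison with `key p` gives η = η^(j^p), which is η^j by Fermat.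
  obtain ⟨m, hm⟩ := exists_apply_eq_mul hζ (σ ^ p) hα0
    (pow_apply_eq_on_kummerExt hζ σ hα)
  have h1 := key p
  rw [hm, map_mul, AlgEquiv.commutes, hi] at h1
  have hzm : algebraMap F Ω (ζ ^ m) ≠ 0 := by
    simpa using fun h0 => absurd h0 (hζ.ne_zero hp.ne_zero)
  have h2 : η ^ 1 = η ^ j ^ p := by
    apply (algebraMap F Ω).injective
    have : (algebraMap F Ω (ζ ^ m) * α) * algebraMap F Ω (η ^ 1) =
        (algebraMap F Ω (ζ ^ m) * α) * algebraMap F Ω (η ^ j ^ p) := by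
      rw [pow_one]; linear_combination h1
    exact mul_left_cancel₀ (mul_ne_zero hzm hα0) this
  have h3 : η ^ j = η := by
    have hmod : j ^ p ≡ j [MOD p] := by
      rw [← ZMod.natCast_eq_natCast_iff, Nat.cast_pow, ZMod.pow_card]
    rw [← pow_eq_pow_of_modEq hmod hηp.pow_eq_one, ← h2, pow_one]
  rw [← hσρ, hj, h3, hi]

include hζ in
lemma commute_on_roundStep [IsSepClosure F Ω] (σ : Gal(Ω/F)) {τ : Gal(Ω/F)}
    (hτ : ∀ x ∈ kummerExt p F Ω, τ x = x) {x : Ω} (hx : x ∈ roundStep p (kummerExt p F Ω)) :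
    τ (σ x) = σ (τ x) := by
  have hK : ∀ x ∈ kummerExt p F Ω, τ (σ x) = σ (τ x) := fun x hx =>
    commute_on_kummerExt hζ σ τ hx
  -- Lying in the fixed field of the commutator is a condition that passes to compositums, so each L
  -- can be treated separately.
  have h1 : roundStep p (kummerExt p F Ω) ≤
      fixedField (Subgroup.zpowers ((σ * τ)⁻¹ * (τ * σ))) := by
    refine sup_le ?_ (sSup_le ?_)
    · rw [le_fixedField_zpowers_iff]
      exact fun x hx => (commutator_apply_eq_iff σ τ x).2 (hK x hx)
    · rintro L ⟨hL, hLF⟩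
      rw [le_fixedField_zpowers_iff]
      intro x hx
      rw [commutator_apply_eq_iff]
      obtain ⟨α, hα, hαK, hLα⟩ := IsGaloisOfDegree.exists_eq_adjoin hζ hL
      have hstab : ∀ (σ : Gal(Ω/F)), ∀ x ∈ L, σ x ∈ L := by
        intro σ x hx
        have hn : Normal F L := hLF.to_normal
        exact (normal_iff_forall_map_le'.1 hn σ) ⟨x, hx, rfl⟩
      have hα0 : α ≠ 0 := by rintro rfl; exact hαK (zero_mem _)
      rw [hLα] at hx
      refine commute_on_adjoin ?_ hx
      rintro y (hy | rfl)
      · exact hK y hy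
      · exact commute_on_generator hζ hstab hα hα0 hLα σ hτ
  exact (commutator_apply_eq_iff σ τ x).1 ((le_fixedField_zpowers_iff _ _).1 h1 x hx)

lemma mem_of_forall_fixing [IsSepClosure F Ω] (K : IntermediateField F Ω) {x : Ω}
    (h : ∀ τ : Gal(Ω/F), (∀ y ∈ K, τ y = y) → τ x = x) : x ∈ K := by
  rw [← InfiniteGalois.fixedField_fixingSubgroup K, mem_fixedField_iff]
  exact fun τ hτ => h τ ((IntermediateField.mem_fixingSubgroup_iff K τ).1 hτ)

include hζ in
lemma exists_pow_eq' [IsSepClosure F Ω] (x : Ω) : ∃ z : Ω, z ^ p = x := by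
  have : IsSepClosed Ω := IsSepClosure.sep_closed F
  have : NeZero (p : Ω) := (hζ.map_of_injective (algebraMap F Ω).injective).neZero'
  exact IsSepClosed.exists_pow_nat_eq x p

include hζ in
-- For a p-th root l of x, an automorphism τ fixing F^(2) multiplies l by a root of unity from F. As
-- τ commutes with σ on l, it multiplies σ l by the same root, so σ l / l is fixed by τ.
lemma actsTrivially_of_roundStep_eq [IsSepClosure F Ω]
    (h : roundStep p (kummerExt p F Ω) = curlyStep p (kummerExt p F Ω)) :
    ActsTrivially p (kummerExt p F Ω) := by
  have hp : p.Prime := Fact.out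
  intro σ x hx
  rcases eq_or_ne x 0 with rfl | hx0
  · exact ⟨1, one_mem _, by simp⟩
  obtain ⟨l, rfl⟩ := exists_pow_eq' hζ x
  have hl : l ∈ roundStep p (kummerExt p F Ω) := by
    rw [h, curlyStep_eq_pRootExtension hζ]
    exact mem_pRootExtension hx
  have hl0 : l ≠ 0 := by rintro rfl; exact hx0 (zero_pow hp.ne_zero)
  refine ⟨σ l / l, mem_of_forall_fixing _ fun τ hτ => ?_, ?_⟩
  · obtain ⟨i, hi⟩ := exists_apply_eq_mul hζ τ hl0 (hτ _ hx)
    have hz : algebraMap F Ω (ζ ^ i) ≠ 0 := by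
      simpa using fun h0 => absurd h0 (hζ.ne_zero hp.ne_zero)
    rw [map_div₀, commute_on_roundStep hζ σ hτ hl, hi, map_mul, AlgEquiv.commutes,
      mul_div_mul_left _ _ hz]
  · rw [map_pow, div_pow]
    field_simp

omit [Fact p.Prime] in
/-- If `σ x = x z` and `σ z = z u ^ p`, then the norm of `x` is a `p`-th power. -/
lemma IsKummerGenerator.exists_norm_eq_pow {E : Type*} [Field E] [Algebra F E] {σ : Gal(E/F)}
    {α : E} {a : F} (h : IsKummerGenerator p σ α ζ a) (hodd : Odd p) {x z u : E}
    (hx : σ x = x * z) (hz : σ z = z * u ^ p) :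
    ∃ e : E, e ^ p = algebraMap F E (Algebra.norm F x) := by
  have h1 : ∀ i : ℕ, ∃ v : E, (σ ^ i) z = z * v ^ p := by
    intro i
    induction i with
    | zero => exact ⟨1, by simp⟩
    | succ i ih =>
      obtain ⟨v, hv⟩ := ih
      exact ⟨u * σ v, by rw [pow_succ', AlgEquiv.mul_apply, hv, map_mul, map_pow, hz]; ring⟩
  have h2 : ∀ i : ℕ, ∃ v : E, (σ ^ i) x = x * z ^ i * v ^ p := by
    intro i
    induction i with
    | zero => exact ⟨1, by simp⟩
    | succ i ih =>
      obtain ⟨v, hv⟩ := ih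
      obtain ⟨w, hw⟩ := h1 i
      exact ⟨v * w, by rw [pow_succ, AlgEquiv.mul_apply, hx, map_mul, hv, hw]; ring⟩
  choose v hv using h2
  rw [h.norm_eq, Finset.prod_congr rfl fun i _ => hv i, Finset.prod_mul_distrib,
    Finset.prod_mul_distrib, Finset.prod_const, Finset.card_range, Finset.prod_pow_eq_pow_sum,
    Finset.prod_pow]
  obtain ⟨m, hm⟩ := hodd
  have h3 : ∑ i ∈ Finset.range p, i = m * p := by
    have h4 := Finset.sum_range_id_mul_two p
    have : p - 1 = m * 2 := by omega
    rw [this, ← mul_assoc, mul_comm p m] at h4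
    exact Nat.eq_of_mul_eq_mul_right two_pos h4
  rw [h3]
  exact ⟨x * z ^ m * ∏ i ∈ Finset.range p, v i, by ring⟩

include hζ in
theorem isPRigid_of_actsTrivially [IsSepClosure F Ω] (hodd : Odd p)
    (h : ActsTrivially p (kummerExt p F Ω)) : IsPRigid p F := by
  have hp : p.Prime := Fact.out
  intro a ha
  refine ⟨ha, fun x => ?_⟩
  have : Fact (Irreducible (X ^ p - C a)) := ⟨X_pow_sub_C_irreducible_of_prime hp ha⟩
  obtain ⟨σ, hσ⟩ := exists_isKummerGenerator (E := AdjoinRoot (X ^ p - C a)) hζ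
    (root_X_pow_sub_C_pow p a) ha (adjoin_root_eq_top _)
  -- By Kummer theory, the elements of F that are p-th powers in F(a^(1/p)) are those in some a^k
  -- F^p.
  suffices H : ∃ e, e ^ p = algebraMap F _ (Algebra.norm F x) by
    obtain ⟨e, he⟩ := H
    exact hσ.exists_of_pow_eq he
  rcases eq_or_ne x 0 with rfl | hx0
  · refine ⟨0, ?_⟩
    rw [hσ.norm_eq, zero_pow hp.ne_zero]
    exact (Finset.prod_eq_zero (Finset.mem_range.2 hp.pos) (map_zero (σ ^ 0))).symm
  obtain ⟨β, hβ⟩ := exists_pow_eq' hζ (algebraMap F Ω a)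
  let ι : AdjoinRoot (X ^ p - C a) →ₐ[F] Ω :=
    AdjoinRoot.liftAlgHom (X ^ p - C a) (Algebra.ofId _ _) β (by simp [hβ])
  let _ : Algebra (AdjoinRoot (X ^ p - C a)) Ω := ι.toRingHom.toAlgebra
  have hιa : ∀ y, algebraMap (AdjoinRoot (X ^ p - C a)) Ω y = ι y := fun _ => rfl
  have : IsScalarTower F (AdjoinRoot (X ^ p - C a)) Ω :=
    IsScalarTower.of_algebraMap_eq fun y => (ι.commutes y).symm
  have hιK : ∀ y, ι y ∈ kummerExt p F Ω := by
    intro y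
    obtain ⟨c, rfl⟩ := hσ.exists_sum y
    rw [map_sum]
    refine sum_mem fun i _ => ?_
    rw [map_mul, map_pow, ι.commutes]
    have hroot : ι (AdjoinRoot.root (X ^ p - C a)) ^ p = algebraMap F Ω a := by
      rw [← map_pow, root_X_pow_sub_C_pow]
      exact ι.commutes a
    have hmem : ι (AdjoinRoot.root (X ^ p - C a)) ∈ kummerExt p F Ω := by
      rw [kummerExt]
      exact subset_adjoin F _ ⟨a, hroot⟩
    exact mul_mem (IntermediateField.algebraMap_mem _ _) (pow_mem hmem _)
  let s : Gal(Ω/F) := σ.liftNormal Ω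
  have hs : ∀ y, s (ι y) = ι (σ y) := fun y => σ.liftNormal_commutes Ω y
  obtain ⟨y, hy, hxy⟩ := h s (ι x) (hιK x)
  have hιx : ι x ≠ 0 := (map_ne_zero_iff _ ι.injective).2 hx0
  have hσx : σ x ≠ 0 := (map_ne_zero_iff _ σ.injective).2 hx0
  have hz : ι (σ x / x) = y ^ p := by
    rw [map_div₀, ← hs, hxy, mul_div_cancel_left₀ _ hιx]
  have hy0 : y ≠ 0 := by
    rintro rfl
    rw [zero_pow hp.ne_zero] at hz
    exact div_ne_zero hσx hx0 ((map_eq_zero_iff ι ι.injective).1 hz)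
  -- Here y^p = σ x / x is in the image of E, so an automorphism τ fixing that image scales y by a
  -- root of unity. The action on F^(2) is abelian, so τ scales s y by the same root, and the
  -- quotient descends to E.
  obtain ⟨u, hu⟩ : s y / y ∈ ι.fieldRange := by
    refine mem_of_forall_fixing _ fun τ hτ => ?_
    have hτz : τ (y ^ p) = y ^ p := hτ _ ⟨_, hz⟩
    obtain ⟨i, hi⟩ := exists_apply_eq_mul hζ τ hy0 hτz
    have hne : algebraMap F Ω (ζ ^ i) ≠ 0 := by
      simpa using fun h0 => absurd h0 (hζ.ne_zero hp.ne_zero)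
    rw [map_div₀, commute_on_kummerExt hζ s τ hy, hi, map_mul, AlgEquiv.commutes,
      mul_div_mul_left _ _ hne]
  refine hσ.exists_norm_eq_pow hodd (x := x) (z := σ x / x) (u := u) (by field_simp) ?_
  have hu' : ι u = s y / y := hu
  suffices H : ι (σ (σ x / x)) = ι (σ x / x * u ^ p) from ι.injective H
  rw [← hs, hz, map_mul, hz, map_pow ι, hu', map_pow, div_pow]
  field_simp

end Converse

end

end RigidField

theorem theoremA (p : ℕ) (hp : p.Prime) (hodd : Odd p)
    (F : Type*) [Field F] (hζ : ∃ ζ : F, IsPrimitiveRoot ζ p)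
    (Ω : Type*) [Field Ω] [Algebra F Ω] [IsSepClosure F Ω] :
    (RigidField.IsPRigid p F ↔
      RigidField.roundField p F Ω 3 = RigidField.curlyField p F Ω 3) ∧
    (RigidField.IsPRigid p F →
      ∀ n : ℕ, 2 ≤ n → RigidField.curlyField p F Ω n = RigidField.roundField p F Ω n) ∧
    (¬ RigidField.IsPRigid p F →
      RigidField.roundField p F Ω 3 < RigidField.curlyField p F Ω 3) := by
  have : Fact p.Prime := ⟨hp⟩
  obtain ⟨ζ, hζ⟩ := hζ
  have h1 : RigidField.IsPRigid p F → ∀ n : ℕ, 2 ≤ n →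
      RigidField.curlyField p F Ω n = RigidField.roundField p F Ω n := by
    intro h n hn
    obtain ⟨m, rfl⟩ := Nat.exists_eq_add_of_le' hn
    exact h.curlyField_eq_roundField hζ hodd m
  have h2 : RigidField.roundField p F Ω 3 = RigidField.curlyField p F Ω 3 →
      RigidField.IsPRigid p F := fun h =>
    RigidField.isPRigid_of_actsTrivially hζ hodd (RigidField.actsTrivially_of_roundStep_eq hζ h)
  exact ⟨⟨fun h => (h1 h 3 (by norm_num)).symm, h2⟩, h1, fun h =>
    lt_of_le_of_ne RigidField.roundStep_le_curlyStep fun heq => h (h2 heq)⟩
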